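/- Let $D$ be an integral domain with quotient field $K$, and write $\mathbb N=\{1,2,\dots\}$. Let $F(D)$ be the set of nonzero fractional ideals of $D$, and for $A\in F(D)$ put $A^{-1}=\{x\in K : xA\subseteq D\}$ and $A_v=(A^{-1})^{-1}$. A *star-operation* on $D$ is a map $A\mapsto A_\ast$ from $F(D)$ to $F(D)$ such that for all $A,B\in F(D)$ and $0\ne x\in K$: $(x)_\ast=(x)$ and $(xA)_\ast=xA_\ast$; $A\subseteq A_\ast$, and $A\subseteq B$ implies $A_\ast\subseteq B_\ast$; $(A_\ast)_\ast=A_\ast$. (Put also $0_\ast=0$.) It is of *finite character* if $A_\ast=\bigcup\{B_\ast : 0\ne B\subseteq A,\ B \text{ a finitely generated fractional ideal}\}$ for every $A\in F(D)$. Fix a star-operation $\ast$ of finite character on $D$, and use the following terms. * A fractional ideal $A\in F(D)$ is a *$\ast$-ideal* if $A_\ast=A$, and *$\ast$-invertible* if $(AA^{-1})_\ast=D$. A *maximal $\ast$-ideal* is a maximal element of the set of nonzero proper ideals $P\subsetneq D$ with $P_\ast=P$; such ideals are prime, and $\ast\text{-}\mathrm{Max}(D)$ is the set of them. * $D$ is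 *$\ast$-h-local* if $D=\bigcap_{P\in\ast\text{-}\mathrm{Max}(D)}D_P$ inside $K$, every nonzero nonunit of $D$ lies in only finitely many $P\in\ast\text{-}\mathrm{Max}(D)$, and no two distinct members of $\ast\text{-}\mathrm{Max}(D)$ contain a common nonzero prime ideal. * A domain $R$ is an *almost valuation domain* if for all nonzero $a,b\in R$ there is $n\in\mathbb N$ with $a^n\mid b^n$ or $b^n\mid a^n$. $D$ is a *$\ast$-almost independent ring of Krull type* ($\ast$-almost IRKT) if it is $\ast$-h-local and $D_P$ is an almost valuation domain for every $P\in\ast\text{-}\mathrm{Max}(D)$. * $D$ is an *almost GCD domain* if for all nonzero $a,b\in D$ there is $n\in\mathbb N$ with $(a^n,b^n)_v$ principal. * An ideal $A$ of $D$ is *$\ast$-homogeneous* if it is nonzero, finitely generated, and contained in exactly one maximal $\ast$-ideal, denoted $M(A)$. * An ideal $A$ of $D$ is *$\ast$-almost factorial general-homogeneous* ($\ast$-afg-homogeneous) if it is $\ast$-invertible and $\ast$-homogeneous, and for all $b_1,\dots,b_s\in M(A)$ such that $A^r\subseteq(b_1,\dots,b_s)_\ast$ for some $r\in\mathbb N$,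 there is $n\in\mathbb N$ with $(b_1^n,\dots,b_s^n)_\ast$ principal. * $D$ is a *$\ast$-almost factorial general-SH domain* if for every nonzero nonunit $x\in D$ there are finitely many $\ast$-afg-homogeneous ideals $A_1,\dots,A_k$ of $D$ with $xD=(A_1\cdots A_k)_\ast$. * The *$\ast$-class group* $Cl_\ast(D)$ is the group of $\ast$-invertible fractional $\ast$-ideals of $D$ under $(I,J)\mapsto(IJ)_\ast$, modulo the subgroup of nonzero principal fractional ideals. **Theorem 5.5.** Let $D$ be an integral domain and $\ast$ a finite character star-operation on $D$. The following statements are equivalent. 1. $D$ is a $\ast$-almost factorial general-SH domain. 2. $D$ is a $\ast$-almost IRKT and an almost GCD domain. 3. $D$ is a $\ast$-almost IRKT and $Cl_\ast(D)$ is a torsion group. 4. $D$ is $\ast$-h-local and every $\ast$-invertible $\ast$-homogeneous ideal of $D$ is $\ast$-afg-homogeneous. -/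

import Mathlib

open scoped nonZeroDivisors

/-- A star-operation on the domain `D` with quotient field `K`: a map `A ↦ A_∗` on the nonzero
fractional ideals of `D`. It is extended to the zero fractional ideal by `0_∗ = 0`, so that the
map is determined by its values on nonzero fractional ideals. -/
structure StarOperation (D K : Type*) [CommRing D] [IsDomain D] [Field K] [Algebra D K]
    [IsFractionRing D K] where
  /-- The map `A ↦ A_∗`. -/
  star : FractionalIdeal D⁰ K → FractionalIdeal D⁰ K
  star_zero : star 0 = 0
  star_spanSingleton : ∀ x : K, x ≠ 0 →
    star (FractionalIdeal.spanSingleton D⁰ x) = FractionalIdeal.spanSingleton D⁰ x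
  star_smul : ∀ (x : K) (A : FractionalIdeal D⁰ K), x ≠ 0 → A ≠ 0 →
    star (FractionalIdeal.spanSingleton D⁰ x * A) = FractionalIdeal.spanSingleton D⁰ x * star A
  le_star : ∀ A : FractionalIdeal D⁰ K, A ≠ 0 → A ≤ star A
  star_mono : ∀ A B : FractionalIdeal D⁰ K, A ≠ 0 → B ≠ 0 → A ≤ B → star A ≤ star B
  star_star : ∀ A : FractionalIdeal D⁰ K, A ≠ 0 → star (star A) = star A

/-- An almost valuation domain: for nonzero `a, b` some `aⁿ ∣ bⁿ` or `bⁿ ∣ aⁿ` with `n ≥ 1`. -/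
def IsAVDomain (R : Type*) [CommRing R] : Prop :=
  IsDomain R ∧ ∀ a b : R, a ≠ 0 → b ≠ 0 → ∃ n : ℕ, 0 < n ∧ (a ^ n ∣ b ^ n ∨ b ^ n ∣ a ^ n)

section Domain

variable (D K : Type*) [CommRing D] [IsDomain D] [Field K] [Algebra D K] [IsFractionRing D K]

/-- An almost GCD domain: for nonzero `a, b` there is `n ≥ 1` with `(aⁿ, bⁿ)_v` principal, where
`A_v = (A⁻¹)⁻¹`. -/
def IsAGCDDomain : Prop :=
  ∀ a b : D, a ≠ 0 → b ≠ 0 → ∃ n : ℕ, 0 < n ∧ ∃ c : D,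
    (((Ideal.span {a ^ n, b ^ n} : Ideal D) : FractionalIdeal D⁰ K)⁻¹)⁻¹ =
      ((Ideal.span {c} : Ideal D) : FractionalIdeal D⁰ K)

variable {D}

/-- `D` is an `F`-IFC domain: `F` is a defining family of primes (`D = ⋂ D_P` inside `K`), it is
of finite character, and it is independent. -/
structure IsIFC (F : Set (PrimeSpectrum D)) : Prop where
  defining : (⨅ P ∈ F, Localization.subalgebra.ofField K P.asIdeal.primeCompl
    P.asIdeal.primeCompl_le_nonZeroDivisors) = (⊥ : Subalgebra D K)
  finite_character : ∀ x : D, x ≠ 0 → ¬ IsUnit x → {P ∈ F | x ∈ P.asIdeal}.Finite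
  independent : ∀ P ∈ F, ∀ Q ∈ F, P ≠ Q →
    ¬ ∃ N : Ideal D, N.IsPrime ∧ N ≠ ⊥ ∧ N ≤ P.asIdeal ∧ N ≤ Q.asIdeal

end Domain

namespace StarOperation

variable {D K : Type*} [CommRing D] [IsDomain D] [Field K] [Algebra D K] [IsFractionRing D K]
  (s : StarOperation D K)

/-- Finite character: `A_∗` is the union of the `B_∗` over nonzero finitely generated fractional
ideals `B ⊆ A`. -/
def FiniteCharacter : Prop :=
  ∀ A : FractionalIdeal D⁰ K, A ≠ 0 → ∀ x : K, x ∈ s.star A ↔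
    ∃ B : FractionalIdeal D⁰ K, B ≠ 0 ∧ (B : Submodule D K).FG ∧ B ≤ A ∧ x ∈ s.star B

/-- `A` is `∗`-invertible: `(A A⁻¹)_∗ = D`. -/
def IsInvertible (A : FractionalIdeal D⁰ K) : Prop := s.star (A * A⁻¹) = 1

/-- `P` is a proper nonzero integral `∗`-ideal. -/
def IsProperStarIdeal (P : Ideal D) : Prop :=
  P ≠ ⊥ ∧ P ≠ ⊤ ∧ s.star (P : FractionalIdeal D⁰ K) = (P : FractionalIdeal D⁰ K)

/-- `P` is a maximal `∗`-ideal: maximal among the proper nonzero integral `∗`-ideals. -/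
def IsMaximalStarIdeal (P : Ideal D) : Prop :=
  s.IsProperStarIdeal P ∧ ∀ Q : Ideal D, s.IsProperStarIdeal Q → P ≤ Q → Q = P

/-- The set `∗-Max(D)`; see `IsMaximalStarIdeal.isPrime` for the primality. -/
def starMax : Set (PrimeSpectrum D) := {P | s.IsMaximalStarIdeal P.asIdeal}

/-- `D` is `∗`-h-local: it is a `∗-Max(D)`-IFC domain. -/
def IsHLocal : Prop := IsIFC K s.starMax

/-- `D` is a `∗`-almost independent ring of Krull type. -/
def IsAlmostIRKT : Prop :=
  s.IsHLocal ∧ ∀ P ∈ s.starMax, IsAVDomain (Localization.AtPrime P.asIdeal)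

/-- `A` is `P`-`∗`-homogeneous: nonzero, finitely generated, and `P` is the unique maximal
`∗`-ideal containing `A`. -/
structure IsHomogeneousAt (A P : Ideal D) : Prop where
  ne_bot : A ≠ ⊥
  fg : A.FG
  isMaximal : s.IsMaximalStarIdeal P
  le : A ≤ P
  unique : ∀ Q : Ideal D, s.IsMaximalStarIdeal Q → A ≤ Q → Q = P

/-- `A` is `∗`-homogeneous. -/
def IsHomogeneous (A : Ideal D) : Prop := ∃ P : Ideal D, s.IsHomogeneousAt A P

/-- `A` is `∗`-almost factorial general-homogeneous (`∗`-afg-homogeneous). -/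
def IsAfgHomogeneous (A : Ideal D) : Prop :=
  s.IsInvertible (A : FractionalIdeal D⁰ K) ∧
  ∃ P : Ideal D, s.IsHomogeneousAt A P ∧
    ∀ (k : ℕ) (b : Fin k → D), (∀ i, b i ∈ P) →
      (∃ r : ℕ, 0 < r ∧ ((A ^ r : Ideal D) : FractionalIdeal D⁰ K) ≤
        s.star ((Ideal.span (Set.range b) : Ideal D) : FractionalIdeal D⁰ K)) →
      ∃ n : ℕ, 0 < n ∧ ∃ c : D,
        s.star ((Ideal.span (Set.range fun i => b i ^ n) : Ideal D) : FractionalIdeal D⁰ K) =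
          ((Ideal.span {c} : Ideal D) : FractionalIdeal D⁰ K)

/-- `D` is a `∗`-almost factorial general-SH domain: every nonzero proper principal ideal is a
`∗`-product of finitely many `∗`-afg-homogeneous ideals. -/
def IsAfgSHDomain : Prop :=
  ∀ x : D, x ≠ 0 → ¬ IsUnit x → ∃ L : Multiset (Ideal D), (∀ A ∈ L, s.IsAfgHomogeneous A) ∧
    ((Ideal.span {x} : Ideal D) : FractionalIdeal D⁰ K) =
      s.star ((L.prod : Ideal D) : FractionalIdeal D⁰ K)

/-! Basic facts on star-operations, needed for the primality of maximal `∗`-ideals and for the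
group structure on `∗`-invertible `∗`-ideals. -/

lemma le_star' (A : FractionalIdeal D⁰ K) : A ≤ s.star A := by
  by_cases h : A = 0
  · rw [h, s.star_zero]
  · exact s.le_star A h

lemma star_mono' {A B : FractionalIdeal D⁰ K} (h : A ≤ B) : s.star A ≤ s.star B := by
  by_cases hA : A = 0
  · rw [hA, s.star_zero]; exact FractionalIdeal.zero_le _
  · refine s.star_mono A B hA ?_ h
    rintro rfl
    exact hA (FractionalIdeal.le_zero_iff.mp h)

lemma star_star' (A : FractionalIdeal D⁰ K) : s.star (s.star A) = s.star A := by
  by_cases h : A = 0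
  · rw [h, s.star_zero, s.star_zero]
  · exact s.star_star A h

lemma star_one : s.star 1 = 1 := by
  have h := s.star_spanSingleton 1 one_ne_zero
  rwa [FractionalIdeal.spanSingleton_one] at h

lemma star_mul_le (A B : FractionalIdeal D⁰ K) : s.star A * B ≤ s.star (A * B) := by
  rw [FractionalIdeal.mul_le]
  intro a ha b hb
  by_cases hb0 : b = 0
  · rw [hb0, mul_zero]; exact FractionalIdeal.zero_mem _
  by_cases hA : A = 0
  · rw [hA, s.star_zero, FractionalIdeal.mem_zero_iff] at ha
    rw [ha, zero_mul]; exact FractionalIdeal.zero_mem _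
  have h1 : s.star (FractionalIdeal.spanSingleton D⁰ b * A) ≤ s.star (A * B) := by
    refine s.star_mono' ?_
    rw [mul_comm]
    gcongr
    rwa [FractionalIdeal.spanSingleton_le_iff_mem]
  rw [s.star_smul b A hb0 hA] at h1
  rw [mul_comm a b]
  exact h1 (FractionalIdeal.mul_mem_mul (FractionalIdeal.mem_spanSingleton_self _ _) ha)

lemma star_star_mul (A B : FractionalIdeal D⁰ K) : s.star (s.star A * B) = s.star (A * B) := by
  apply le_antisymm
  · exact (s.star_mono' (s.star_mul_le A B)).trans (s.star_star' _).le
  · refine s.star_mono' ?_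
    gcongr
    exact s.le_star' A

lemma star_mul_star (A B : FractionalIdeal D⁰ K) : s.star (A * s.star B) = s.star (A * B) := by
  rw [mul_comm, s.star_star_mul, mul_comm]

/-- An ideal strictly containing a maximal `∗`-ideal has `∗`-closure `D`. -/
lemma star_eq_one_of_lt {P I : Ideal D} (hP : s.IsMaximalStarIdeal P) (h : P < I) :
    s.star (I : FractionalIdeal D⁰ K) = 1 := by
  have hle : s.star (I : FractionalIdeal D⁰ K) ≤ 1 := by
    have := s.star_mono' (FractionalIdeal.coeIdeal_le_one (S := D⁰) (P := K) (I := I))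
    rwa [s.star_one] at this
  obtain ⟨J, hJ⟩ := FractionalIdeal.le_one_iff_exists_coeIdeal.mp hle
  have hIJ : I ≤ J := by
    rw [← FractionalIdeal.coeIdeal_le_coeIdeal K, hJ]
    exact s.le_star' _
  by_cases hJt : J = ⊤
  · rw [← hJ, hJt, FractionalIdeal.coeIdeal_top]
  · exfalso
    have hPJ : P < J := h.trans_le hIJ
    have hJs : s.IsProperStarIdeal J := by
      refine ⟨fun hb => ?_, hJt, ?_⟩
      · rw [hb] at hPJ; exact not_lt_bot hPJ
      · rw [hJ]; exact s.star_star' _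
    exact hPJ.ne (hP.2 J hJs hPJ.le).symm

/-- Maximal `∗`-ideals are prime, so `starMax` contains all of them. -/
theorem IsMaximalStarIdeal.isPrime {s : StarOperation D K} {P : Ideal D}
    (hP : s.IsMaximalStarIdeal P) : P.IsPrime := by
  refine ⟨hP.1.2.1, ?_⟩
  intro a b hab
  by_contra hcon
  push Not at hcon
  obtain ⟨ha, hb⟩ := hcon
  have key : ∀ c : D, c ∉ P → P < P ⊔ Ideal.span {c} := by
    intro c hc
    refine lt_of_le_of_ne le_sup_left fun h => hc ?_
    rw [h]
    exact Ideal.mem_sup_right (Ideal.mem_span_singleton_self c)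
  have h1 := s.star_eq_one_of_lt hP (key a ha)
  have h2 := s.star_eq_one_of_lt hP (key b hb)
  have hmul : (P ⊔ Ideal.span {a}) * (P ⊔ Ideal.span {b}) ≤ P := by
    rw [Ideal.sup_mul, Ideal.mul_sup, Ideal.mul_sup, Ideal.span_singleton_mul_span_singleton]
    refine sup_le (sup_le Ideal.mul_le_left Ideal.mul_le_left)
      (sup_le Ideal.mul_le_right ?_)
    rwa [Ideal.span_singleton_le_iff_mem]
  have h3 : s.star (((P ⊔ Ideal.span {a}) * (P ⊔ Ideal.span {b}) : Ideal D) :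
      FractionalIdeal D⁰ K) = 1 := by
    rw [FractionalIdeal.coeIdeal_mul, ← s.star_star_mul, ← s.star_mul_star, h1, h2, mul_one,
      s.star_one]
  have h4 : (1 : FractionalIdeal D⁰ K) ≤ P := by
    rw [← h3, ← hP.1.2.2]
    exact s.star_mono' ((FractionalIdeal.coeIdeal_le_coeIdeal K).mpr hmul)
  rw [← FractionalIdeal.coeIdeal_top, FractionalIdeal.coeIdeal_le_coeIdeal] at h4
  exact hP.1.2.1 (top_le_iff.mp h4)

lemma IsInvertible.ne_zero {s : StarOperation D K} {A : FractionalIdeal D⁰ K}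
    (h : s.IsInvertible A) : A ≠ 0 := by
  rintro rfl
  rw [IsInvertible, zero_mul, s.star_zero] at h
  exact zero_ne_one h

lemma le_inv_of_mul_le_one {A B : FractionalIdeal D⁰ K} (hA : A ≠ 0) (h : A * B ≤ 1) :
    B ≤ A⁻¹ := by
  intro x hx
  rw [FractionalIdeal.mem_inv_iff hA]
  intro y hy
  rw [mul_comm]
  exact h (FractionalIdeal.mul_mem_mul hy hx)

lemma mul_inv_le_one (A : FractionalIdeal D⁰ K) : A * A⁻¹ ≤ 1 := by
  rw [FractionalIdeal.inv_eq]
  exact FractionalIdeal.mul_one_div_le_one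

/-- A fractional ideal with a `∗`-inverse is `∗`-invertible. -/
lemma isInvertible_of_star_mul_eq_one {A B : FractionalIdeal D⁰ K} (h : s.star (A * B) = 1) :
    s.IsInvertible A := by
  have hA : A ≠ 0 := by
    rintro rfl
    rw [zero_mul, s.star_zero] at h
    exact zero_ne_one h
  refine le_antisymm ((s.star_mono' (mul_inv_le_one A)).trans s.star_one.le) ?_
  rw [← h]
  refine s.star_mono' ?_
  gcongr
  exact le_inv_of_mul_le_one hA ((s.le_star' _).trans h.le)

lemma star_inv (A : FractionalIdeal D⁰ K) : s.star A⁻¹ = A⁻¹ := by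
  by_cases hA : A = 0
  · rw [hA, FractionalIdeal.inv_zero', s.star_zero]
  refine le_antisymm (le_inv_of_mul_le_one hA ?_) (s.le_star' _)
  calc A * s.star A⁻¹ = s.star A⁻¹ * A := mul_comm _ _
    _ ≤ s.star (A⁻¹ * A) := s.star_mul_le _ _
    _ ≤ s.star 1 := s.star_mono' (by rw [mul_comm]; exact mul_inv_le_one A)
    _ = 1 := s.star_one

/-- The set `∗-Inv(D)` of `∗`-invertible fractional `∗`-ideals. -/
@[ext]
structure StarInv where
  /-- The underlying fractional ideal. -/
  val : FractionalIdeal D⁰ K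
  star_val : s.star val = val
  isInvertible : s.IsInvertible val

/-- `∗-Inv(D)` is an abelian group under the `∗`-product `(I, J) ↦ (I J)_∗`. -/
noncomputable instance : CommGroup s.StarInv where
  mul A B := ⟨s.star (A.val * B.val), s.star_star' _,
    s.isInvertible_of_star_mul_eq_one (B := A.val⁻¹ * B.val⁻¹) (by
      rw [s.star_star_mul, mul_mul_mul_comm, ← s.star_star_mul, A.isInvertible, one_mul,
        B.isInvertible])⟩
  one := ⟨1, s.star_one, s.isInvertible_of_star_mul_eq_one (B := 1) (by
    rw [one_mul, s.star_one])⟩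
  inv A := ⟨A.val⁻¹, s.star_inv _, s.isInvertible_of_star_mul_eq_one (B := A.val) (by
    rw [mul_comm]; exact A.isInvertible)⟩
  mul_assoc A B C := StarInv.ext (by
    change s.star (s.star (A.val * B.val) * C.val) = s.star (A.val * s.star (B.val * C.val))
    rw [s.star_star_mul, s.star_mul_star, mul_assoc])
  one_mul A := StarInv.ext (by
    change s.star (1 * A.val) = A.val
    rw [one_mul, A.star_val])
  mul_one A := StarInv.ext (by
    change s.star (A.val * 1) = A.val
    rw [mul_one, A.star_val])
  inv_mul_cancel A := StarInv.ext (by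
    change s.star (A.val⁻¹ * A.val) = 1
    rw [mul_comm]; exact A.isInvertible)
  mul_comm A B := StarInv.ext (by
    change s.star (A.val * B.val) = s.star (B.val * A.val)
    rw [mul_comm])

/-- The subgroup `Prin(D)` of nonzero principal fractional ideals. -/
noncomputable def prin : Subgroup s.StarInv where
  carrier := {A | ∃ x : K, x ≠ 0 ∧ A.val = FractionalIdeal.spanSingleton D⁰ x}
  mul_mem' := by
    rintro A B ⟨x, hx, hA⟩ ⟨y, hy, hB⟩
    refine ⟨x * y, mul_ne_zero hx hy, ?_⟩
    change s.star (A.val * B.val) = _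
    rw [hA, hB, FractionalIdeal.spanSingleton_mul_spanSingleton,
      s.star_spanSingleton _ (mul_ne_zero hx hy)]
  one_mem' := ⟨1, one_ne_zero, FractionalIdeal.spanSingleton_one.symm⟩
  inv_mem' := by
    rintro A ⟨x, hx, hA⟩
    refine ⟨x⁻¹, inv_ne_zero hx, ?_⟩
    change A.val⁻¹ = _
    rw [hA, FractionalIdeal.spanSingleton_inv]

/-- The `∗`-class group `Cl_∗(D) = ∗-Inv(D) / Prin(D)`. -/
abbrev StarClassGroup : Type _ := s.StarInv ⧸ s.prin

end StarOperation

/-! Everything is tested locally at the maximal `∗`-ideals. Finite character makes membership in a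
`∗`-closure local (`FiniteCharacter.mem_star_of_local`), so `∗`-invertibility of a nonzero ideal
means that any given generating set `S` contains, at each maximal `∗`-ideal, a local generator
(`IsLocallyPrincipal`). For such `S` the `n`-th powers of its elements generate, up to closure, the
`n`-th power of the ideal (`IsLocallyPrincipal.closure_span_pow`). This links the class group, which
concerns `I ^ n`, with the afg and almost GCD conditions, which concern ideals generated by `n`-th
powers.

In an h-local domain the local behaviour at one `P` can be isolated by a homogeneous ideal, so each
`∗`-invertible ideal is a `∗`-product of homogeneous ones (`IsHLocal.exists_factorization`), and
torsion need only be checked on those.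

From (1) to (4), take `0 ≠ x ∈ A` and factor it. The factors inside `P = M(A)` yield an element `c`,
locally a multiple of `x`, that has the afg property; a power of `c` lies in every closure above a
power of `A`, so `A` inherits the property. Condition (4) gives almost valuation localizations by
applying the afg property to `a`, `b` and generators of a homogeneous `A` with `A D_P = a D_P`.
Conversely, almost valuation makes a finite set locally principal after a power, and torsion makes
the closure principal after another. Almost GCD and torsion are interchangeable because `v` and `∗`
agree on `∗`-invertible ideals and a homogeneous invertible ideal has the closure of a two-generated
one. -/

namespace StarOperation

variable {D K : Type*} [CommRing D] [IsDomain D] [Field K] [Algebra D K] [IsFractionRing D K]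
  (s : StarOperation D K)

/-! ### The star-operation as a closure operator on integral ideals. -/

section Closure

/-- The `∗`-closure of an integral ideal, as an integral ideal. -/
noncomputable def closure (I : Ideal D) : Ideal D :=
  (s.star (I : FractionalIdeal D⁰ K) : Submodule D K).comap (Algebra.linearMap D K)

variable {s}

lemma mem_closure {I : Ideal D} {x : D} :
    x ∈ s.closure I ↔ algebraMap D K x ∈ s.star (I : FractionalIdeal D⁰ K) := Iff.rfl

lemma coe_closure (I : Ideal D) :
    (s.closure I : FractionalIdeal D⁰ K) = s.star (I : FractionalIdeal D⁰ K) := by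
  have hle : s.star (I : FractionalIdeal D⁰ K) ≤ 1 := by
    have := s.star_mono' (FractionalIdeal.coeIdeal_le_one (S := D⁰) (P := K) (I := I))
    rwa [s.star_one] at this
  obtain ⟨J, hJ⟩ := FractionalIdeal.le_one_iff_exists_coeIdeal.mp hle
  have : s.closure I = J := by
    ext x
    rw [mem_closure, ← hJ, FractionalIdeal.mem_coeIdeal]
    constructor
    · rintro ⟨y, hy, h⟩
      rwa [← IsFractionRing.injective D K h]
    · exact fun h => ⟨x, h, rfl⟩
  rw [this, hJ]

lemma star_eq_coe_iff {I J : Ideal D} :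
    s.star (I : FractionalIdeal D⁰ K) = (J : FractionalIdeal D⁰ K) ↔ s.closure I = J := by
  rw [← coe_closure, FractionalIdeal.coeIdeal_inj]

lemma star_eq_star_iff {I J : Ideal D} :
    s.star (I : FractionalIdeal D⁰ K) = s.star (J : FractionalIdeal D⁰ K) ↔
      s.closure I = s.closure J := by
  rw [← coe_closure J, star_eq_coe_iff]

lemma coe_le_star_iff {I J : Ideal D} :
    (J : FractionalIdeal D⁰ K) ≤ s.star (I : FractionalIdeal D⁰ K) ↔ J ≤ s.closure I := by
  rw [← coe_closure, FractionalIdeal.coeIdeal_le_coeIdeal]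

lemma star_eq_one_iff {I : Ideal D} :
    s.star (I : FractionalIdeal D⁰ K) = 1 ↔ s.closure I = ⊤ := by
  rw [← FractionalIdeal.coeIdeal_top, star_eq_coe_iff]

lemma le_closure (I : Ideal D) : I ≤ s.closure I := coe_le_star_iff.mp (s.le_star' _)

lemma closure_mono {I J : Ideal D} (h : I ≤ J) : s.closure I ≤ s.closure J := by
  rw [← coe_le_star_iff, coe_closure]
  exact s.star_mono' ((FractionalIdeal.coeIdeal_le_coeIdeal K).mpr h)

@[simp]
lemma closure_closure (I : Ideal D) : s.closure (s.closure I) = s.closure I := by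
  rw [← star_eq_star_iff, coe_closure, s.star_star']

lemma closure_le_iff {I J : Ideal D} : s.closure I ≤ s.closure J ↔ I ≤ s.closure J :=
  ⟨(le_closure I).trans, fun h => (closure_mono h).trans (closure_closure J).le⟩

lemma closure_closure_mul (I J : Ideal D) :
    s.closure (s.closure I * J) = s.closure (I * J) := by
  rw [← star_eq_star_iff, FractionalIdeal.coeIdeal_mul, coe_closure, s.star_star_mul,
    FractionalIdeal.coeIdeal_mul]

lemma closure_mul_closure (I J : Ideal D) :
    s.closure (I * s.closure J) = s.closure (I * J) := by
  rw [mul_comm, closure_closure_mul, mul_comm]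

lemma closure_mul_closure_le (I J : Ideal D) :
    s.closure I * s.closure J ≤ s.closure (I * J) := by
  rw [← closure_closure_mul, ← closure_mul_closure]
  exact le_closure _

lemma closure_pow_congr {I J : Ideal D} (h : s.closure I = s.closure J) (n : ℕ) :
    s.closure (I ^ n) = s.closure (J ^ n) := by
  induction n with
  | zero => simp
  | succ n ih =>
    rw [pow_succ, pow_succ, ← closure_closure_mul, ih, closure_closure_mul,
      ← closure_mul_closure, h, closure_mul_closure]

lemma closure_pow_le (I : Ideal D) (n : ℕ) : s.closure I ^ n ≤ s.closure (I ^ n) := by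
  rw [← closure_pow_congr (closure_closure I)]
  exact le_closure _

lemma closure_bot : s.closure (⊥ : Ideal D) = ⊥ := by
  rw [← star_eq_coe_iff, FractionalIdeal.coeIdeal_bot, s.star_zero]

lemma closure_top : s.closure (⊤ : Ideal D) = ⊤ := top_le_iff.mp (le_closure _)

lemma closure_span_singleton_mul (x : D) (I : Ideal D) :
    s.closure (Ideal.span {x} * I) = Ideal.span {x} * s.closure I := by
  by_cases hx : x = 0
  · rw [hx, Ideal.span_singleton_eq_bot.mpr rfl, Ideal.bot_mul, Ideal.bot_mul, closure_bot]
  by_cases hI : I = ⊥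
  · rw [hI, Ideal.mul_bot, closure_bot, Ideal.mul_bot]
  rw [← star_eq_coe_iff, FractionalIdeal.coeIdeal_mul, FractionalIdeal.coeIdeal_mul,
    FractionalIdeal.coeIdeal_span_singleton, coe_closure, s.star_smul]
  · simpa using hx
  · simpa using hI

lemma closure_span_singleton (x : D) : s.closure (Ideal.span {x}) = Ideal.span {x} := by
  have := closure_span_singleton_mul (s := s) x ⊤
  rwa [closure_top, Ideal.mul_top] at this

lemma closure_coe_eq_span_of_spanSingleton {I : Ideal D} {x : K}
    (h : s.star (I : FractionalIdeal D⁰ K) = FractionalIdeal.spanSingleton D⁰ x) :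
    ∃ c : D, s.closure I = Ideal.span {c} := by
  have hx : x ∈ s.star (I : FractionalIdeal D⁰ K) := by
    rw [h]; exact FractionalIdeal.mem_spanSingleton_self _ _
  rw [← coe_closure, FractionalIdeal.mem_coeIdeal] at hx
  obtain ⟨c, -, rfl⟩ := hx
  refine ⟨c, ?_⟩
  rw [← star_eq_coe_iff, h, FractionalIdeal.coeIdeal_span_singleton]

lemma IsMaximalStarIdeal.closure_eq {P : Ideal D} (hP : s.IsMaximalStarIdeal P) :
    s.closure P = P := star_eq_coe_iff.mp hP.1.2.2

lemma IsMaximalStarIdeal.closure_le_iff {P I : Ideal D} (hP : s.IsMaximalStarIdeal P) :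
    s.closure I ≤ P ↔ I ≤ P := by
  rw [← hP.closure_eq, StarOperation.closure_le_iff]

end Closure

/-! ### Finite character: existence of maximal `∗`-ideals and local membership. -/

section FiniteCharacter

variable {s}

lemma FiniteCharacter.exists_fg (hs : s.FiniteCharacter) {I : Ideal D} {x : D}
    (hx : x ∈ s.closure I) : ∃ J : Ideal D, J.FG ∧ J ≤ I ∧ x ∈ s.closure J := by
  by_cases hI : I = ⊥
  · exact ⟨I, hI ▸ Submodule.fg_bot, le_rfl, hx⟩
  obtain ⟨B, -, hfg, hBI, hxB⟩ := (hs I (FractionalIdeal.coeIdeal_ne_zero.mpr hI) _).mp hx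
  obtain ⟨J, rfl⟩ := FractionalIdeal.le_one_iff_exists_coeIdeal.mp
    (hBI.trans FractionalIdeal.coeIdeal_le_one)
  refine ⟨J, ?_, (FractionalIdeal.coeIdeal_le_coeIdeal K).mp hBI, hxB⟩
  exact (FractionalIdeal.coeIdeal_fg D⁰ (IsFractionRing.injective D K) J).mp hfg

/-- For a star-operation of finite character, an ideal whose closure is proper is contained in a
maximal `∗`-ideal. -/
lemma FiniteCharacter.exists_le_isMaximalStarIdeal (hs : s.FiniteCharacter) {I : Ideal D}
    (hI : I ≠ ⊥) (h : s.closure I ≠ ⊤) : ∃ P, s.IsMaximalStarIdeal P ∧ I ≤ P := by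
  obtain ⟨P, hIP, hP⟩ := zorn_le_nonempty₀ {J : Ideal D | s.closure J = J ∧ J ≠ ⊤} (by
    intro c hc hchain J hJ
    have hmem : ∀ x, x ∈ sSup c ↔ ∃ L ∈ c, x ∈ L := fun x =>
      Submodule.mem_sSup_of_directed ⟨J, hJ⟩ hchain.directedOn
    refine ⟨sSup c, ⟨?_, ?_⟩, fun L hL => le_sSup hL⟩
    · refine le_antisymm (fun x hx => ?_) (le_closure _)
      -- Finite character makes the union of a chain closed: `x` already lies in the closure of a
      -- finitely generated `B`, and `B` sits in one member of the chain.
      obtain ⟨B, hfg, hB, hxB⟩ := hs.exists_fg hx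
      obtain ⟨L, hL, hBL⟩ : ∃ L ∈ c, B ≤ L :=
        (Submodule.fg_iff_compact B).mp hfg c _ ⟨J, hJ⟩ hchain.directedOn (isLUB_sSup c) hB
      exact (hmem x).mpr ⟨L, hL, by rw [← (hc hL).1]; exact closure_mono hBL hxB⟩
    · intro htop
      obtain ⟨L, hL, h1⟩ := (hmem 1).mp (htop ▸ Submodule.mem_top)
      exact (hc hL).2 ((Ideal.eq_top_iff_one _).mpr h1)) (s.closure I) ⟨closure_closure I, h⟩
  refine ⟨P, ⟨⟨?_, hP.1.2, star_eq_coe_iff.mpr hP.1.1⟩, ?_⟩, (le_closure I).trans hIP⟩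
  · rintro rfl
    exact hI (le_bot_iff.mp ((le_closure I).trans hIP))
  · exact fun Q hQ hPQ => (hP.2 ⟨star_eq_coe_iff.mp hQ.2.2, hQ.2.1⟩ hPQ).antisymm hPQ

/-- Membership in a `∗`-closure is local at the maximal `∗`-ideals. -/
lemma FiniteCharacter.mem_star_of_local (hs : s.FiniteCharacter) {A : FractionalIdeal D⁰ K}
    (hA : A ≠ 0) {x : K}
    (h : ∀ P, s.IsMaximalStarIdeal P → ∃ t ∉ P, algebraMap D K t * x ∈ s.star A) :
    x ∈ s.star A := by
  by_cases hx : x = 0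
  · rw [hx]; exact FractionalIdeal.zero_mem _
  -- `T` is the ideal of denominators of `x` relative to `A_∗`. By hypothesis it lies in no maximal
  -- `∗`-ideal, so `T_∗ = D`, and `x T ⊆ A_∗` gives `x ∈ x T_∗ ⊆ A_∗`.
  let T : Ideal D := (s.star A : Submodule D K).comap (LinearMap.toSpanSingleton D K x)
  have hT : ∀ t, t ∈ T ↔ algebraMap D K t * x ∈ s.star A := fun t => by
    rw [← Algebra.smul_def]; rfl
  have hTA : FractionalIdeal.spanSingleton D⁰ x * (T : FractionalIdeal D⁰ K) ≤ s.star A := by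
    rw [FractionalIdeal.spanSingleton_mul_le_iff]
    intro z hz
    obtain ⟨t, ht, rfl⟩ := (FractionalIdeal.mem_coeIdeal _).mp hz
    rw [mul_comm]
    exact (hT t).mp ht
  have hTbot : T ≠ ⊥ := by
    obtain ⟨a, haA, ha⟩ : ∃ a ∈ A, a ≠ 0 := by
      by_contra! hcon
      exact hA (FractionalIdeal.eq_zero_iff.mpr hcon)
    obtain ⟨p, q, hq, hpq⟩ := IsFractionRing.div_surjective D (a / x)
    have hq0 : algebraMap D K q ≠ 0 := IsFractionRing.to_map_ne_zero_of_mem_nonZeroDivisors hq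
    rw [div_eq_div_iff hq0 hx] at hpq
    refine (Submodule.ne_bot_iff _).mpr ⟨p, (hT p).mpr ?_, ?_⟩
    · rw [hpq, mul_comm, ← Algebra.smul_def]
      exact Submodule.smul_mem _ _ (s.le_star' A haA)
    · rintro rfl
      rw [map_zero, zero_mul] at hpq
      exact mul_ne_zero ha hq0 hpq.symm
  have hTtop : s.closure T = ⊤ := by
    by_contra hne
    obtain ⟨P, hP, hTP⟩ := hs.exists_le_isMaximalStarIdeal hTbot hne
    obtain ⟨t, htP, ht⟩ := h P hP
    exact htP (hTP ((hT t).mpr ht))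
  have h1 := s.star_mono' hTA
  rw [s.star_star', s.star_smul _ _ hx (FractionalIdeal.coeIdeal_ne_zero.mpr hTbot),
    star_eq_one_iff.mpr hTtop, mul_one] at h1
  exact h1 (FractionalIdeal.mem_spanSingleton_self _ _)

lemma FiniteCharacter.mem_closure_of_local (hs : s.FiniteCharacter) {I : Ideal D} (hI : I ≠ ⊥)
    {x : D} (h : ∀ P, s.IsMaximalStarIdeal P → ∃ t ∉ P, t * x ∈ s.closure I) :
    x ∈ s.closure I := by
  refine hs.mem_star_of_local (FractionalIdeal.coeIdeal_ne_zero.mpr hI) fun P hP => ?_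
  obtain ⟨t, ht, hx⟩ := h P hP
  exact ⟨t, ht, by rw [Algebra.linearMap_apply, ← map_mul]; exact hx⟩

lemma FiniteCharacter.le_closure_of_local (hs : s.FiniteCharacter) {I J : Ideal D} (hI : I ≠ ⊥)
    (h : ∀ P, s.IsMaximalStarIdeal P → ∃ t ∉ P, Ideal.span {t} * J ≤ s.closure I) :
    J ≤ s.closure I := fun _ hx => hs.mem_closure_of_local hI fun P hP =>
  let ⟨t, ht, hJ⟩ := h P hP
  ⟨t, ht, hJ (Ideal.mul_mem_mul (Ideal.mem_span_singleton_self t) hx)⟩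

end FiniteCharacter

end StarOperation

lemma Ideal.span_singleton_mul_span_le_iff {D : Type*} [CommRing D] {t b : D} {S : Set D} :
    Ideal.span {t} * Ideal.span S ≤ Ideal.span {b} ↔ ∀ x ∈ S, b ∣ t * x := by
  rw [Ideal.span_mul_span', Ideal.span_le]
  simp [Set.subset_def, Set.singleton_mul, Ideal.mem_span_singleton]

namespace StarOperation

variable {D K : Type*} [CommRing D] [IsDomain D] [Field K] [Algebra D K] [IsFractionRing D K]
  (s : StarOperation D K)

/-! ### Invertibility as local principality, and torsion in the class group. -/

section LocallyPrincipal

/-- At every maximal `∗`-ideal, the ideal generated by `S` is locally generated by some element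
of `S`. -/
def IsLocallyPrincipal (S : Set D) : Prop :=
  ∀ P, s.IsMaximalStarIdeal P → ∃ t ∉ P, ∃ b ∈ S, ∀ x ∈ S, b ∣ t * x

variable {s}

lemma IsLocallyPrincipal.pow {S : Set D} (h : s.IsLocallyPrincipal S) (n : ℕ) :
    s.IsLocallyPrincipal ((· ^ n) '' S) := by
  intro P hP
  obtain ⟨t, ht, b, hb, hS⟩ := h P hP
  have := hP.isPrime
  refine ⟨t ^ n, fun hc => ht (this.mem_of_pow_mem n hc), b ^ n, ⟨b, hb, rfl⟩, ?_⟩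
  rintro _ ⟨x, hx, rfl⟩
  simp only [← mul_pow]
  exact pow_dvd_pow_of_dvd (hS x hx) n

lemma span_pow_image_ne_bot {S : Set D} (hS : Ideal.span S ≠ ⊥) (n : ℕ) :
    Ideal.span ((· ^ n) '' S) ≠ ⊥ := by
  rw [Ne, Ideal.span_eq_bot] at hS ⊢
  push Not at hS ⊢
  obtain ⟨x, hx, h0⟩ := hS
  exact ⟨x ^ n, ⟨x, hx, rfl⟩, pow_ne_zero n h0⟩

/-- If `b ∈ S` generates the ideal at `P`, then both sides are generated by `b ^ n` at `P`; mixed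
products of elements of `S` contribute nothing new. -/
lemma IsLocallyPrincipal.closure_span_pow (hs : s.FiniteCharacter) {S : Set D}
    (hS : Ideal.span S ≠ ⊥) (h : s.IsLocallyPrincipal S) (n : ℕ) :
    s.closure (Ideal.span ((· ^ n) '' S)) = s.closure (Ideal.span S ^ n) := by
  refine le_antisymm (closure_mono ?_) (closure_le_iff.mpr ?_)
  · rw [Ideal.span_le]
    rintro _ ⟨x, hx, rfl⟩
    exact Ideal.pow_mem_pow (Ideal.subset_span hx) n
  · refine hs.le_closure_of_local (span_pow_image_ne_bot hS n) fun P hP => ?_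
    obtain ⟨t, ht, b, hb, hbS⟩ := h P hP
    have := hP.isPrime
    refine ⟨t ^ n, fun hc => ht (this.mem_of_pow_mem n hc), ?_⟩
    rw [← Ideal.span_singleton_pow, ← mul_pow]
    refine (Ideal.pow_right_mono (Ideal.span_singleton_mul_span_le_iff.mpr hbS) n).trans ?_
    rw [Ideal.span_singleton_pow]
    refine le_trans ?_ (le_closure _)
    exact Ideal.span_mono (Set.singleton_subset_iff.mpr ⟨b, hb, rfl⟩)

/-- If no `b ∈ S` were a generator at `P`, each product `y b` with `y ∈ I⁻¹` would lie in `P`,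
forcing `I I⁻¹ ⊆ P` and contradicting invertibility. -/
lemma IsInvertible.isLocallyPrincipal {S : Set D}
    (h : s.IsInvertible (Ideal.span S : FractionalIdeal D⁰ K)) : s.IsLocallyPrincipal S := by
  intro P hP
  set I := Ideal.span S with hI
  have hI0 : (I : FractionalIdeal D⁰ K) ≠ 0 := h.ne_zero
  by_contra! hcon
  have hle : (I : FractionalIdeal D⁰ K) * (I : FractionalIdeal D⁰ K)⁻¹ ≤ P := by
    rw [mul_comm, FractionalIdeal.mul_le]
    intro y hy z hz
    obtain ⟨x, hx, rfl⟩ := (FractionalIdeal.mem_coeIdeal _).mp hz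
    have hyI := (FractionalIdeal.mem_inv_iff hI0).mp hy
    have hmem : ∀ x ∈ I, ∃ d : D, algebraMap D K d = y * algebraMap D K x := fun x hx => by
      simpa [FractionalIdeal.mem_one_iff] using
        hyI _ (FractionalIdeal.mem_coeIdeal_of_mem _ hx)
    clear hz
    induction hx using Submodule.span_induction with
    | mem b hb =>
      obtain ⟨t, ht⟩ := hmem b (Ideal.subset_span hb)
      rw [← ht]
      refine FractionalIdeal.mem_coeIdeal_of_mem _ ?_
      by_contra htP
      obtain ⟨x, hx, hbx⟩ := hcon t htP b hb
      obtain ⟨d, hd⟩ := hmem x (Ideal.subset_span hx)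
      refine hbx ⟨d, IsFractionRing.injective D K ?_⟩
      rw [map_mul, map_mul, ht, hd]
      ring
    | zero => rw [map_zero, mul_zero]; exact FractionalIdeal.zero_mem _
    | add a b _ _ ha hb =>
      rw [map_add, mul_add]
      exact Submodule.add_mem _ ha hb
    | smul d a _ ha =>
      rw [smul_eq_mul, map_mul, mul_left_comm, ← Algebra.smul_def]
      exact Submodule.smul_mem _ _ ha
  have h1 := s.star_mono' hle
  rw [hP.1.2.2, show s.star _ = 1 from h, ← FractionalIdeal.coeIdeal_top,
    FractionalIdeal.coeIdeal_le_coeIdeal] at h1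
  exact hP.1.2.1 (top_le_iff.mp h1)

/-- From `b ∣ t * x` on `S` one gets `t / b ∈ I⁻¹`, so `t ∈ I I⁻¹` is outside `P`; hence `I I⁻¹`
lies in no maximal `∗`-ideal. -/
lemma IsLocallyPrincipal.isInvertible (hs : s.FiniteCharacter) {S : Set D}
    (hS : Ideal.span S ≠ ⊥) (h : s.IsLocallyPrincipal S) :
    s.IsInvertible (Ideal.span S : FractionalIdeal D⁰ K) := by
  set I := Ideal.span S with hI
  have hI0 : (I : FractionalIdeal D⁰ K) ≠ 0 := FractionalIdeal.coeIdeal_ne_zero.mpr hS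
  obtain ⟨J, hJ⟩ := FractionalIdeal.le_one_iff_exists_coeIdeal.mp
    (mul_inv_le_one (I : FractionalIdeal D⁰ K))
  have hIJ : I ≤ J := by
    rw [← FractionalIdeal.coeIdeal_le_coeIdeal K, hJ]
    nth_rewrite 1 [← mul_one (I : FractionalIdeal D⁰ K)]
    gcongr
    exact le_inv_of_mul_le_one hI0 (by rw [mul_one]; exact FractionalIdeal.coeIdeal_le_one)
  rw [IsInvertible, ← hJ, star_eq_one_iff]
  by_contra hne
  obtain ⟨P, hP, hJP⟩ := hs.exists_le_isMaximalStarIdeal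
    (fun hb => hS (le_bot_iff.mp (hb ▸ hIJ))) hne
  obtain ⟨t, ht, b, hb, hbS⟩ := h P hP
  have hbI := Ideal.span_singleton_mul_span_le_iff.mpr hbS
  have ht0 : t ≠ 0 := fun h0 => ht (h0 ▸ P.zero_mem)
  have hb0 : b ≠ 0 := by
    rintro rfl
    rw [Ideal.span_singleton_eq_bot.mpr rfl, le_bot_iff, Ideal.mul_eq_bot] at hbI
    exact hbI.elim (by simpa using ht0) hS
  have hb0' : algebraMap D K b ≠ 0 := by simpa using hb0
  have hinv : algebraMap D K t / algebraMap D K b ∈ (I : FractionalIdeal D⁰ K)⁻¹ := by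
    rw [FractionalIdeal.mem_inv_iff hI0]
    intro z hz
    obtain ⟨x, hx, rfl⟩ := (FractionalIdeal.mem_coeIdeal _).mp hz
    obtain ⟨d, hd⟩ := Ideal.mem_span_singleton.mp
      (hbI (Ideal.mul_mem_mul (Ideal.mem_span_singleton_self t) hx))
    rw [FractionalIdeal.mem_one_iff]
    refine ⟨d, ?_⟩
    rw [div_mul_eq_mul_div, ← map_mul, hd, map_mul, mul_div_cancel_left₀ _ hb0']
  have hmem := FractionalIdeal.mul_mem_mul
    (FractionalIdeal.mem_coeIdeal_of_mem D⁰ (Ideal.subset_span hb : b ∈ I)) hinv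
  rw [mul_div_cancel₀ _ hb0', ← hJ, FractionalIdeal.mem_coeIdeal] at hmem
  obtain ⟨t', ht', h'⟩ := hmem
  rw [IsFractionRing.injective D K h'] at ht'
  exact ht (hJP ht')

lemma IsInvertible.exists_local_generator {I P : Ideal D}
    (h : s.IsInvertible (I : FractionalIdeal D⁰ K)) (hP : s.IsMaximalStarIdeal P) :
    ∃ t ∉ P, ∃ b ∈ I, ∀ x ∈ I, b ∣ t * x := by
  rw [← Submodule.span_eq I] at h
  exact h.isLocallyPrincipal P hP

lemma isInvertible_of_local (hs : s.FiniteCharacter) {I : Ideal D} (hI : I ≠ ⊥)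
    (h : ∀ P, s.IsMaximalStarIdeal P → ∃ t ∉ P, ∃ b ∈ I, ∀ x ∈ I, b ∣ t * x) :
    s.IsInvertible (I : FractionalIdeal D⁰ K) := by
  have hspan : Ideal.span (I : Set D) = I := Submodule.span_eq I
  rw [← hspan]
  exact IsLocallyPrincipal.isInvertible hs (by rwa [hspan]) h

lemma isInvertible_span_singleton {c : D} (hc : c ≠ 0) :
    s.IsInvertible ((Ideal.span {c} : Ideal D) : FractionalIdeal D⁰ K) := by
  have : algebraMap D K c ≠ 0 := by simpa using hc
  rw [IsInvertible, FractionalIdeal.coeIdeal_span_singleton, FractionalIdeal.spanSingleton_inv,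
    FractionalIdeal.spanSingleton_mul_spanSingleton, mul_inv_cancel₀ this,
    FractionalIdeal.spanSingleton_one, s.star_one]

lemma isInvertible_star_iff {A : FractionalIdeal D⁰ K} :
    s.IsInvertible (s.star A) ↔ s.IsInvertible A := by
  constructor <;> intro h
  · exact s.isInvertible_of_star_mul_eq_one (B := (s.star A)⁻¹) (by rw [← s.star_star_mul]; exact h)
  · exact s.isInvertible_of_star_mul_eq_one (B := A⁻¹) (by rw [s.star_star_mul]; exact h)

lemma isInvertible_congr {I J : Ideal D} (h : s.closure I = s.closure J) :
    s.IsInvertible (I : FractionalIdeal D⁰ K) ↔ s.IsInvertible (J : FractionalIdeal D⁰ K) := by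
  rw [← isInvertible_star_iff, star_eq_star_iff.mpr h, isInvertible_star_iff]

/-- The class in `∗-Inv(D)` of a `∗`-invertible fractional ideal. -/
def IsInvertible.toStarInv {A : FractionalIdeal D⁰ K} (h : s.IsInvertible A) : s.StarInv :=
  ⟨s.star A, s.star_star' A, isInvertible_star_iff.mpr h⟩

/-- On `∗`-invertible ideals, the `∗`-closure is the `v`-closure. -/
lemma IsInvertible.inv_inv_eq_star {A : FractionalIdeal D⁰ K} (h : s.IsInvertible A) :
    (A⁻¹)⁻¹ = s.star A := by
  have hinv : (s.star A)⁻¹ = A⁻¹ := by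
    have hA := h.ne_zero
    refine le_antisymm (le_inv_of_mul_le_one hA ?_) (le_inv_of_mul_le_one ?_ ?_)
    · exact le_trans (by gcongr; exact s.le_star' A) (mul_inv_le_one (s.star A))
    · exact (isInvertible_star_iff.mpr h).ne_zero
    · exact (s.star_mul_le _ _).trans h.le
  have := congrArg StarInv.val (inv_inv h.toStarInv)
  change ((s.star A)⁻¹)⁻¹ = s.star A at this
  rwa [hinv] at this

lemma StarInv.val_pow (A : s.StarInv) (n : ℕ) : (A ^ n).val = s.star (A.val ^ n) := by
  induction n with
  | zero => rw [pow_zero, pow_zero, s.star_one]; rfl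
  | succ n ih =>
    rw [pow_succ, pow_succ, ← s.star_star_mul, ← ih]
    rfl

lemma star_star_pow (A : FractionalIdeal D⁰ K) (n : ℕ) :
    s.star (s.star A ^ n) = s.star (A ^ n) := by
  induction n with
  | zero => simp
  | succ n ih =>
    rw [pow_succ, pow_succ, s.star_mul_star, ← s.star_star_mul, ih, s.star_star_mul]

/-- Clearing a denominator changes a fractional ideal only by a principal factor, so every class has
an integral representative. -/
lemma isMulTorsion_starClassGroup_iff : IsMulTorsion s.StarClassGroup ↔
    ∀ I : Ideal D, s.IsInvertible (I : FractionalIdeal D⁰ K) →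
      ∃ n : ℕ, 0 < n ∧ ∃ c : D, s.closure (I ^ n) = Ideal.span {c} := by
  have key : IsMulTorsion s.StarClassGroup ↔ ∀ A : s.StarInv, ∃ n : ℕ, 0 < n ∧
      ∃ x : K, x ≠ 0 ∧ s.star (A.val ^ n) = FractionalIdeal.spanSingleton D⁰ x := by
    have : ∀ (A : s.StarInv) (n : ℕ), ((A : s.StarClassGroup) ^ n = 1 ↔
        ∃ x : K, x ≠ 0 ∧ s.star (A.val ^ n) = FractionalIdeal.spanSingleton D⁰ x) := by
      intro A n
      rw [← QuotientGroup.mk_pow, QuotientGroup.eq_one_iff, ← StarInv.val_pow]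
      rfl
    constructor
    · intro h A
      obtain ⟨n, hn, h1⟩ := isOfFinOrder_iff_pow_eq_one.mp (h (A : s.StarClassGroup))
      exact ⟨n, hn, (this A n).mp h1⟩
    · intro h A
      obtain ⟨A, rfl⟩ := QuotientGroup.mk_surjective A
      obtain ⟨n, hn, h1⟩ := h A
      exact isOfFinOrder_iff_pow_eq_one.mpr ⟨n, hn, (this A n).mpr h1⟩
  rw [key]
  constructor
  · intro h I hI
    obtain ⟨n, hn, x, -, hx⟩ := h hI.toStarInv
    refine ⟨n, hn, closure_coe_eq_span_of_spanSingleton (x := x) ?_⟩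
    rw [← hx, FractionalIdeal.coeIdeal_pow]
    exact (star_star_pow _ n).symm
  · intro h A
    obtain ⟨a, I, ha, hAI⟩ := FractionalIdeal.exists_eq_spanSingleton_mul A.val
    have ha' : algebraMap D K a ≠ 0 := by simpa using ha
    have hI0 : (I : FractionalIdeal D⁰ K) ≠ 0 := by
      intro h0
      rw [h0, mul_zero] at hAI
      exact A.isInvertible.ne_zero hAI
    have hI : s.IsInvertible (I : FractionalIdeal D⁰ K) := by
      refine s.isInvertible_of_star_mul_eq_one
        (B := FractionalIdeal.spanSingleton D⁰ (algebraMap D K a)⁻¹ * A.val⁻¹) ?_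
      rw [mul_left_comm, ← mul_assoc, ← hAI]
      exact A.isInvertible
    obtain ⟨n, hn, c, hc⟩ := h I hI
    have hIn : (I : FractionalIdeal D⁰ K) ^ n ≠ 0 := by
      rw [← FractionalIdeal.coeIdeal_pow, FractionalIdeal.coeIdeal_ne_zero]
      exact pow_ne_zero n (FractionalIdeal.coeIdeal_ne_zero.mp hI0)
    have hstar : s.star ((I : FractionalIdeal D⁰ K) ^ n) =
        FractionalIdeal.spanSingleton D⁰ (algebraMap D K c) := by
      rw [← FractionalIdeal.coeIdeal_pow, star_eq_coe_iff.mpr hc,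
        FractionalIdeal.coeIdeal_span_singleton]
    refine ⟨n, hn, (algebraMap D K a)⁻¹ ^ n * algebraMap D K c,
      mul_ne_zero (pow_ne_zero n (inv_ne_zero ha')) ?_, ?_⟩
    · intro h0
      rw [h0, FractionalIdeal.spanSingleton_zero] at hstar
      exact hIn (FractionalIdeal.le_zero_iff.mp (hstar ▸ s.le_star' _))
    · rw [hAI, mul_pow, FractionalIdeal.spanSingleton_pow, s.star_smul _ _ _ hIn, hstar,
        FractionalIdeal.spanSingleton_mul_spanSingleton]
      exact pow_ne_zero n (inv_ne_zero ha')

end LocallyPrincipal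

/-! ### The h-local condition in terms of ideals. -/

section HLocal

variable {s}

/-- The condition `D = ⋂ D_P` is automatic: it is local membership applied to `A = D`. Units lie in
no maximal `∗`-ideal, so the nonunit restriction disappears. -/
lemma isHLocal_iff (hs : s.FiniteCharacter) : s.IsHLocal ↔
    (∀ x : D, x ≠ 0 → {P | s.IsMaximalStarIdeal P ∧ x ∈ P}.Finite) ∧
    ∀ P Q : Ideal D, s.IsMaximalStarIdeal P → s.IsMaximalStarIdeal Q → P ≠ Q →
      ∀ N : Ideal D, N.IsPrime → N ≠ ⊥ → N ≤ P → ¬ N ≤ Q := by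
  constructor
  · intro h
    refine ⟨fun x hx => ?_, fun P Q hP hQ hne N hN hN0 hNP hNQ => ?_⟩
    · by_cases hu : IsUnit x
      · convert Set.finite_empty
        refine Set.eq_empty_of_forall_notMem fun P hP => ?_
        exact hP.1.1.2.1 (Ideal.eq_top_of_isUnit_mem _ hP.2 hu)
      · refine ((h.finite_character x hx hu).image PrimeSpectrum.asIdeal).subset ?_
        rintro P ⟨hP, hxP⟩
        exact ⟨⟨P, hP.isPrime⟩, ⟨hP, hxP⟩, rfl⟩
    · exact h.independent ⟨P, hP.isPrime⟩ hP ⟨Q, hQ.isPrime⟩ hQ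
        (fun h => hne (congrArg PrimeSpectrum.asIdeal h)) ⟨N, hN, hN0, hNP, hNQ⟩
  · rintro ⟨hfin, hind⟩
    refine ⟨?_, fun x hx _ => ?_, fun P hP Q hQ hne ⟨N, hN, hN0, hNP, hNQ⟩ => ?_⟩
    · refine le_bot_iff.mp fun x hx => ?_
      simp only [Algebra.mem_iInf] at hx
      have hx1 : x ∈ s.star 1 := by
        refine hs.mem_star_of_local one_ne_zero fun P hP => ?_
        obtain ⟨a, t, ht, rfl⟩ := hx ⟨P, hP.isPrime⟩ hP
        refine ⟨t, ht, ?_⟩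
        have ht0 : algebraMap D K t ≠ 0 := by
          rw [Ne, IsFractionRing.to_map_eq_zero_iff]
          rintro rfl
          exact ht P.zero_mem
        rw [s.star_one, FractionalIdeal.mem_one_iff]
        exact ⟨a, by field_simp⟩
      rw [s.star_one, FractionalIdeal.mem_one_iff] at hx1
      exact Algebra.mem_bot.mpr hx1
    · refine ((hfin x hx).preimage (f := PrimeSpectrum.asIdeal) ?_).subset fun P hP => hP
      exact fun P _ Q _ h => PrimeSpectrum.ext h
    · exact hind _ _ hP hQ (fun h => hne (PrimeSpectrum.ext h)) N hN hN0 hNP hNQ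

end HLocal

end StarOperation

/-! ### Localizations and independent primes, expressed by divisibility in `D`. -/

/-- The almost valuation property of `D_P`, expressed in `D`. -/
lemma isAVDomain_localization_iff {D : Type*} [CommRing D] [IsDomain D] (P : Ideal D)
    [hP : P.IsPrime] : IsAVDomain (Localization.AtPrime P) ↔
      ∀ a b : D, ∃ n : ℕ, 0 < n ∧ ∃ t ∉ P, a ^ n ∣ t * b ^ n ∨ b ^ n ∣ t * a ^ n := by
  have hle := P.primeCompl_le_nonZeroDivisors
  have hinj := IsLocalization.injective (Localization.AtPrime P) hle
  have hdvd : ∀ x y : D, (algebraMap D (Localization.AtPrime P) x ∣ algebraMap D _ y) ↔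
      ∃ t ∉ P, x ∣ t * y := by
    intro x y
    constructor
    · rintro ⟨z, hz⟩
      obtain ⟨d, t, rfl⟩ := IsLocalization.exists_mk'_eq P.primeCompl z
      refine ⟨t, t.2, d, hinj ?_⟩
      rw [map_mul, hz, mul_left_comm, IsLocalization.mk'_spec', map_mul]
    · rintro ⟨t, ht, d, hd⟩
      have hu : IsUnit (algebraMap D (Localization.AtPrime P) t) :=
        IsLocalization.map_units _ (⟨t, ht⟩ : P.primeCompl)
      rw [← hu.dvd_mul_left, ← map_mul, hd, map_mul]
      exact dvd_mul_right _ _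
  constructor
  · rintro ⟨-, h⟩ a b
    by_cases ha : a = 0
    · exact ⟨1, one_pos, 1, hP.one_notMem, Or.inr (by simp [ha])⟩
    by_cases hb : b = 0
    · exact ⟨1, one_pos, 1, hP.one_notMem, Or.inl (by simp [hb])⟩
    obtain ⟨n, hn, h⟩ := h (algebraMap D _ a) (algebraMap D _ b)
      (by rwa [Ne, map_eq_zero_iff _ hinj]) (by rwa [Ne, map_eq_zero_iff _ hinj])
    rw [← map_pow, ← map_pow, hdvd, hdvd] at h
    rcases h with ⟨t, ht, h⟩ | ⟨t, ht, h⟩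
    · exact ⟨n, hn, t, ht, Or.inl h⟩
    · exact ⟨n, hn, t, ht, Or.inr h⟩
  · intro h
    refine ⟨IsLocalization.isDomain_localization hle, fun x y _ _ => ?_⟩
    obtain ⟨a, u, rfl⟩ := IsLocalization.exists_mk'_eq P.primeCompl x
    obtain ⟨b, v, rfl⟩ := IsLocalization.exists_mk'_eq P.primeCompl y
    obtain ⟨n, hn, t, ht, h⟩ := h (a * v) (b * u)
    have hmk : ∀ (a : D) (u v : P.primeCompl), Associated
        (IsLocalization.mk' (Localization.AtPrime P) a u) (algebraMap D _ (a * v)) := by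
      intro a u v
      have hu := IsLocalization.map_units (Localization.AtPrime P) (u * v)
      refine ⟨hu.unit, ?_⟩
      rw [IsUnit.unit_spec, Submonoid.coe_mul, map_mul, ← mul_assoc, IsLocalization.mk'_spec,
        map_mul]
    refine ⟨n, hn, ?_⟩
    rw [((hmk a u v).pow_pow (n := n)).dvd_iff_dvd_left,
      ((hmk b v u).pow_pow (n := n)).dvd_iff_dvd_right,
      ((hmk a u v).pow_pow (n := n)).dvd_iff_dvd_right,
      ((hmk b v u).pow_pow (n := n)).dvd_iff_dvd_left, ← map_pow, ← map_pow, hdvd, hdvd]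
    exact h.imp (fun h => ⟨t, ht, h⟩) (fun h => ⟨t, ht, h⟩)

/-- Two primes without a common nonzero prime below them can be separated locally at any nonzero
element. -/
lemma Ideal.exists_dvd_mul_of_independent {D : Type*} [CommRing D] {P Q : Ideal D} [P.IsPrime] [Q.IsPrime]
    (h : ∀ N : Ideal D, N.IsPrime → N ≠ ⊥ → N ≤ P → ¬ N ≤ Q) {a : D} (ha : a ≠ 0) :
    ∃ t ∉ P, ∃ y ∉ Q, a ∣ t * y := by
  by_contra! hcon
  -- Otherwise `(a)` misses the product of the two complements, and a prime over `a` missing it too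
  -- is a nonzero prime inside both `P` and `Q`.
  obtain ⟨N, hN, haN, hdisj⟩ := Ideal.exists_le_prime_disjoint (Ideal.span {a})
    (P.primeCompl ⊔ Q.primeCompl) (by
      refine Set.disjoint_left.mpr fun x hx hxS => ?_
      obtain ⟨t, ht, y, hy, rfl⟩ := Submonoid.mem_sup.mp hxS
      exact hcon t ht y hy (Ideal.mem_span_singleton.mp hx))
  refine h N hN ?_ (fun x hx => ?_) (fun x hx => ?_)
  · rintro rfl
    exact ha (by simpa using haN)
  · by_contra hxP
    exact Set.disjoint_left.mp hdisj hx (Submonoid.mem_sup_left (S := P.primeCompl) hxP)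
  · by_contra hxQ
    exact Set.disjoint_left.mp hdisj hx (Submonoid.mem_sup_right (T := Q.primeCompl) hxQ)

namespace StarOperation

variable {D K : Type*} [CommRing D] [IsDomain D] [Field K] [Algebra D K] [IsFractionRing D K]
  (s : StarOperation D K)

/-! ### Homogeneous factorization in h-local domains. -/

section HLocal

variable {s}

/-- In a `∗`-h-local domain, `a D_P` is generated by a `∗`-invertible ideal which is
`∗`-homogeneous at `P`. -/
lemma IsHLocal.exists_isHomogeneousAt (hs : s.FiniteCharacter) (h : s.IsHLocal) {P : Ideal D}
    (hP : s.IsMaximalStarIdeal P) {a : D} (ha : a ≠ 0) (haP : a ∈ P) :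
    ∃ A : Ideal D, s.IsHomogeneousAt A P ∧ s.IsInvertible (A : FractionalIdeal D⁰ K) ∧ a ∈ A ∧
      ∃ t ∉ P, ∀ x ∈ A, a ∣ t * x := by
  obtain ⟨hfin, hind⟩ := (isHLocal_iff hs).mp h
  have hPp := hP.isPrime
  -- The other maximal `∗`-ideals `Q ∋ a` are removed one at a time: adjoining `y ∉ Q` with `a ∣ u *
  -- y`, `u ∉ P`, leaves the ideal unchanged at `P`.
  have key : ∀ F : Set (Ideal D), F.Finite → (∀ Q ∈ F, s.IsMaximalStarIdeal Q ∧ Q ≠ P) →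
      ∃ A : Ideal D, A.FG ∧ a ∈ A ∧ (∃ t ∉ P, Ideal.span {t} * A ≤ Ideal.span {a}) ∧
        ∀ Q ∈ F, ¬ A ≤ Q := by
    intro F hF
    induction F, hF using Set.Finite.induction_on with
    | empty =>
      refine fun _ => ⟨Ideal.span {a}, Submodule.fg_span_singleton a,
        Ideal.mem_span_singleton_self a, ⟨1, hPp.one_notMem, ?_⟩, by simp⟩
      rw [Ideal.span_singleton_one, Ideal.top_mul]
    | @insert Q F _ _ ih =>
      intro hQF
      obtain ⟨A, hfg, haA, ⟨t, ht, htA⟩, hAF⟩ := ih fun Q hQ => hQF Q (Set.mem_insert_of_mem _ hQ)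
      obtain ⟨hQ, hQP⟩ := hQF Q (Set.mem_insert _ _)
      have := hQ.isPrime
      obtain ⟨u, hu, y, hy, huy⟩ := Ideal.exists_dvd_mul_of_independent
        (hind P Q hP hQ hQP.symm) ha
      refine ⟨A ⊔ Ideal.span {y}, Submodule.FG.sup hfg (Submodule.fg_span_singleton y),
        Ideal.mem_sup_left haA, ⟨t * u, ?_, ?_⟩, ?_⟩
      · exact hPp.mul_notMem ht hu
      · rw [← Ideal.span_singleton_mul_span_singleton, Ideal.mul_sup]
        refine sup_le ?_ ?_
        · rw [mul_comm (Ideal.span {t}), mul_assoc]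
          exact Ideal.mul_le_right.trans htA
        · rw [mul_assoc, Ideal.span_singleton_mul_span_singleton]
          exact Ideal.mul_le_right.trans (Ideal.span_singleton_le_span_singleton.mpr huy)
      · rintro R (rfl | hR) hle
        · exact hy (hle (Ideal.mem_sup_right (Ideal.mem_span_singleton_self y)))
        · exact hAF R hR (le_sup_left.trans hle)
  obtain ⟨A, hfg, haA, ⟨t, ht, htA⟩, hAF⟩ := key
    ({Q | s.IsMaximalStarIdeal Q ∧ a ∈ Q} \ {P}) ((hfin a ha).subset Set.sdiff_subset)
    (fun Q hQ => ⟨hQ.1.1, hQ.2⟩)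
  have hdvd : ∀ x ∈ A, a ∣ t * x := fun x hx => Ideal.mem_span_singleton.mp
    (htA (Ideal.mul_mem_mul (Ideal.mem_span_singleton_self t) hx))
  have hA0 : A ≠ ⊥ := fun h0 => ha (by simpa [h0] using haA)
  have huniq : ∀ Q, s.IsMaximalStarIdeal Q → A ≤ Q → Q = P := by
    intro Q hQ hAQ
    by_contra hne
    exact hAF Q ⟨⟨hQ, hAQ haA⟩, hne⟩ hAQ
  refine ⟨A, ⟨hA0, hfg, hP, fun x hx => ?_, huniq⟩, ?_, haA, t, ht, hdvd⟩
  · exact (hPp.mem_or_mem (P.mem_of_dvd (hdvd x hx) haP)).resolve_left ht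
  · refine isInvertible_of_local hs hA0 fun Q hQ => ?_
    by_cases hQP : Q = P
    · subst hQP
      exact ⟨t, ht, a, haA, hdvd⟩
    · obtain ⟨y, hyA, hyQ⟩ := SetLike.not_le_iff_exists.mp fun hle => hQP (huniq Q hQ hle)
      exact ⟨y, hyQ, y, hyA, fun x _ => dvd_mul_right y x⟩

/-- In a `∗`-h-local domain every `∗`-invertible ideal is a `∗`-product of `∗`-invertible
`∗`-homogeneous ideals. -/
lemma IsHLocal.exists_factorization (hs : s.FiniteCharacter) (h : s.IsHLocal) {J : Ideal D}
    (hJ : s.IsInvertible (J : FractionalIdeal D⁰ K)) :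
    ∃ L : Multiset (Ideal D),
      (∀ A ∈ L, s.IsInvertible (A : FractionalIdeal D⁰ K) ∧ s.IsHomogeneous A) ∧
      s.closure J = s.closure L.prod := by
  classical
  have hJ0 : J ≠ ⊥ := FractionalIdeal.coeIdeal_ne_zero.mp hJ.ne_zero
  obtain ⟨x, hxJ, hx0⟩ := (Submodule.ne_bot_iff _).mp hJ0
  have hfin : {P | s.IsMaximalStarIdeal P ∧ J ≤ P}.Finite :=
    (((isHLocal_iff hs).mp h).1 x hx0).subset fun P hP => ⟨hP.1, hP.2 hxJ⟩
  -- The factor at `P` agrees with `J` at `P`. Being homogeneous, it is trivial at every other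
  -- maximal `∗`-ideal, so the product agrees with `J` everywhere.
  have hex : ∀ P, s.IsMaximalStarIdeal P ∧ J ≤ P → ∃ A : Ideal D, s.IsHomogeneousAt A P ∧
      s.IsInvertible (A : FractionalIdeal D⁰ K) ∧
      (∃ t ∉ P, Ideal.span {t} * J ≤ A) ∧ (∃ t ∉ P, Ideal.span {t} * A ≤ J) := by
    rintro P ⟨hP, hJP⟩
    obtain ⟨t, ht, a, haJ, hta⟩ := hJ.exists_local_generator hP
    have ht0 : t ≠ 0 := fun h0 => ht (h0 ▸ P.zero_mem)
    have ha0 : a ≠ 0 := by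
      rintro rfl
      exact mul_ne_zero ht0 hx0 (zero_dvd_iff.mp (hta x hxJ))
    obtain ⟨A, hA, hAinv, haA, u, hu, hua⟩ := h.exists_isHomogeneousAt hs hP ha0 (hJP haJ)
    refine ⟨A, hA, hAinv, ⟨t, ht, ?_⟩, u, hu, ?_⟩
    · rw [Ideal.span_singleton_mul_le_iff]
      exact fun z hz => A.mem_of_dvd (hta z hz) haA
    · rw [Ideal.span_singleton_mul_le_iff]
      exact fun z hz => J.mem_of_dvd (hua z hz) haJ
  choose! A hA hAinv hJA hAJ using hex
  have hF : ∀ P ∈ hfin.toFinset, s.IsMaximalStarIdeal P ∧ J ≤ P := fun P hP => by simpa using hP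
  set F := hfin.toFinset with hFdef
  refine ⟨F.val.map A, ?_, ?_⟩
  · intro B hB
    obtain ⟨P, hP, rfl⟩ := Multiset.mem_map.mp hB
    exact ⟨hAinv P (hF P hP), P, hA P (hF P hP)⟩
  have hprod0 : ∏ P ∈ F, A P ≠ ⊥ :=
    Finset.prod_ne_zero_iff.mpr fun P hP => (hA P (hF P hP)).ne_bot
  have hnot : ∀ Q, s.IsMaximalStarIdeal Q → ∀ G : Finset (Ideal D), G ⊆ F → Q ∉ G →
      ∃ y ∉ Q, y ∈ ∏ P ∈ G, A P := by
    intro Q hQ G hG hQG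
    have hle : ¬ ∏ P ∈ G, A P ≤ Q := by
      rw [hQ.isPrime.prod_le]
      rintro ⟨P, hP, hle⟩
      exact hQG ((hA P (hF P (hG hP))).unique Q hQ hle ▸ hP)
    obtain ⟨y, hy, hyQ⟩ := SetLike.not_le_iff_exists.mp hle
    exact ⟨y, hyQ, hy⟩
  change s.closure J = s.closure (∏ P ∈ F, A P)
  refine le_antisymm ?_ ?_ <;> rw [closure_le_iff]
  · refine hs.le_closure_of_local hprod0 fun Q hQ => ?_
    by_cases hQF : Q ∈ F
    · obtain ⟨t, ht, htJ⟩ := hJA Q (hF Q hQF)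
      obtain ⟨y, hy, hyG⟩ := hnot Q hQ (F.erase Q) (F.erase_subset Q) (F.notMem_erase Q)
      refine ⟨t * y, hQ.isPrime.mul_notMem ht hy, le_trans ?_ (le_closure _)⟩
      rw [← Ideal.span_singleton_mul_span_singleton, mul_right_comm,
        ← Finset.mul_prod_erase F A hQF]
      exact Ideal.mul_mono htJ ((Ideal.span_singleton_le_iff_mem _).mpr hyG)
    · obtain ⟨y, hy, hyG⟩ := hnot Q hQ F subset_rfl hQF
      refine ⟨y, hy, le_trans ?_ (le_closure _)⟩
      exact Ideal.mul_le_left.trans ((Ideal.span_singleton_le_iff_mem _).mpr hyG)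
  · refine hs.le_closure_of_local hJ0 fun Q hQ => ?_
    by_cases hQF : Q ∈ F
    · obtain ⟨t, ht, htA⟩ := hAJ Q (hF Q hQF)
      refine ⟨t, ht, le_trans ?_ (le_closure _)⟩
      rw [← Finset.mul_prod_erase F A hQF, ← mul_assoc]
      exact Ideal.mul_le_left.trans htA
    · have hJQ : ¬ J ≤ Q := fun hle => hQF (by simpa [F] using ⟨hQ, hle⟩)
      obtain ⟨y, hyJ, hyQ⟩ := SetLike.not_le_iff_exists.mp hJQ
      refine ⟨y, hyQ, le_trans ?_ (le_closure _)⟩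
      exact Ideal.mul_le_left.trans ((Ideal.span_singleton_le_iff_mem _).mpr hyJ)

/-- By factorization the homogeneous classes generate, and a product of elements of finite order in
an abelian group has finite order. -/
lemma IsHLocal.torsion_of_homogeneous (hs : s.FiniteCharacter) (h : s.IsHLocal)
    (hom : ∀ A : Ideal D, s.IsInvertible (A : FractionalIdeal D⁰ K) → s.IsHomogeneous A →
      ∃ n : ℕ, 0 < n ∧ ∃ c : D, s.closure (A ^ n) = Ideal.span {c}) :
    IsMulTorsion s.StarClassGroup := by
  rw [isMulTorsion_starClassGroup_iff]
  intro J hJ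
  obtain ⟨L, hL, hJL⟩ := h.exists_factorization hs hJ
  suffices ∃ n : ℕ, 0 < n ∧ ∃ c : D, s.closure (L.prod ^ n) = Ideal.span {c} by
    obtain ⟨n, hn, c, hc⟩ := this
    exact ⟨n, hn, c, by rw [closure_pow_congr hJL, hc]⟩
  clear hJL
  induction L using Multiset.induction_on with
  | empty => exact ⟨1, one_pos, 1, by simp [closure_top]⟩
  | cons A L ih =>
    obtain ⟨n, hn, c, hc⟩ := ih fun B hB => hL B (Multiset.mem_cons_of_mem hB)
    obtain ⟨hA, hA'⟩ := hL A (Multiset.mem_cons_self A L)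
    obtain ⟨m, hm, d, hd⟩ := hom A hA hA'
    refine ⟨m * n, Nat.mul_pos hm hn, d ^ n * c ^ m, ?_⟩
    have h1 : s.closure ((A ^ m) ^ n) = Ideal.span {d ^ n} := by
      rw [closure_pow_congr (hd.trans (closure_span_singleton d).symm), Ideal.span_singleton_pow,
        closure_span_singleton]
    have h2 : s.closure ((L.prod ^ n) ^ m) = Ideal.span {c ^ m} := by
      rw [closure_pow_congr (hc.trans (closure_span_singleton c).symm), Ideal.span_singleton_pow,
        closure_span_singleton]
    rw [Multiset.prod_cons, mul_pow, pow_mul, mul_comm m n, pow_mul, ← closure_closure_mul, h1,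
      ← closure_mul_closure, h2, Ideal.span_singleton_mul_span_singleton, closure_span_singleton]

end HLocal

/-! ### Afg-homogeneous ideals and their products. -/

section Afg

/-- The defining property of a `∗`-afg-homogeneous ideal, in terms of finite subsets of `P`. -/
def HasPrincipalPowersAbove (A P : Ideal D) : Prop :=
  ∀ S : Set D, S.Finite → S ⊆ P → (∃ r : ℕ, 0 < r ∧ A ^ r ≤ s.closure (Ideal.span S)) →
    ∃ n : ℕ, 0 < n ∧ ∃ c : D, s.closure (Ideal.span ((· ^ n) '' S)) = Ideal.span {c}

variable {s}

lemma isAfgHomogeneous_iff {A : Ideal D} : s.IsAfgHomogeneous A ↔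
    s.IsInvertible (A : FractionalIdeal D⁰ K) ∧
      ∃ P, s.IsHomogeneousAt A P ∧ s.HasPrincipalPowersAbove A P := by
  refine and_congr_right fun _ => exists_congr fun P => and_congr_right fun _ => ?_
  simp only [coe_le_star_iff, star_eq_coe_iff]
  constructor
  · intro h S hS hSP hr
    obtain ⟨k, b, -, rfl⟩ := hS.fin_param
    obtain ⟨n, hn, c, hc⟩ := h k b (fun i => hSP ⟨i, rfl⟩) hr
    exact ⟨n, hn, c, by rwa [← Set.range_comp]⟩
  · intro h k b hb hr
    obtain ⟨n, hn, c, hc⟩ := h (Set.range b) (Set.finite_range b)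
      (Set.range_subset_iff.mpr hb) hr
    exact ⟨n, hn, c, by rwa [← Set.range_comp] at hc⟩

/-- Whatever lies above a power of `B` also lies above a power of `A`. -/
lemma HasPrincipalPowersAbove.of_pow_le {A B P : Ideal D} (h : s.HasPrincipalPowersAbove A P)
    {m : ℕ} (hm : 0 < m) (hAB : A ^ m ≤ s.closure B) : s.HasPrincipalPowersAbove B P := by
  rintro S hS hSP ⟨r, hr, hBr⟩
  refine h S hS hSP ⟨m * r, Nat.mul_pos hm hr, ?_⟩
  rw [pow_mul]
  exact (Ideal.pow_right_mono hAB r).trans ((closure_pow_le B r).trans (closure_le_iff.mpr hBr))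

lemma isHomogeneousAt_span_singleton {A P : Ideal D} (hA : s.IsHomogeneousAt A P) {n : ℕ}
    (hn : 0 < n) {c : D} (hc : s.closure (A ^ n) = Ideal.span {c}) :
    s.IsHomogeneousAt (Ideal.span {c}) P := by
  have key : ∀ Q, s.IsMaximalStarIdeal Q → (Ideal.span {c} ≤ Q ↔ A ≤ Q) := by
    intro Q hQ
    rw [← hc, hQ.closure_le_iff]
    have := hQ.isPrime
    exact this.pow_le_iff hn.ne'
  refine ⟨fun h0 => ?_, Submodule.fg_span_singleton c, hA.isMaximal, (key P hA.isMaximal).mpr hA.le,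
    fun Q hQ hle => hA.unique Q hQ ((key Q hQ).mp hle)⟩
  exact pow_ne_zero n hA.ne_bot (le_bot_iff.mp (h0 ▸ hc ▸ le_closure (A ^ n)))

/-- A principal closure makes the ideal invertible, so at each `P` a local generator can be picked
from `T` itself. -/
lemma isLocallyPrincipal_of_closure_eq_span_singleton {T : Set D} (hT : Ideal.span T ≠ ⊥) {c : D}
    (h : s.closure (Ideal.span T) = Ideal.span {c}) : s.IsLocallyPrincipal T := by
  refine IsInvertible.isLocallyPrincipal ((isInvertible_congr (J := Ideal.span {c}) ?_).mpr
    (isInvertible_span_singleton ?_))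
  · rw [h, closure_span_singleton]
  · rintro rfl
    refine hT (le_bot_iff.mp ?_)
    simpa [h] using le_closure (s := s) (Ideal.span T)

/-- A `∗`-afg-homogeneous ideal has a power whose `∗`-closure is principal. -/
lemma HasPrincipalPowersAbove.exists_closure_pow (hs : s.FiniteCharacter) {A P : Ideal D}
    (h : s.HasPrincipalPowersAbove A P) (hA : s.IsHomogeneousAt A P)
    (hinv : s.IsInvertible (A : FractionalIdeal D⁰ K)) :
    ∃ n : ℕ, 0 < n ∧ ∃ c : D, s.closure (A ^ n) = Ideal.span {c} := by
  obtain ⟨S, rfl⟩ := hA.fg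
  obtain ⟨n, hn, c, hc⟩ := h S S.finite_toSet (fun x hx => hA.le (Ideal.subset_span hx))
    ⟨1, one_pos, by rw [pow_one]; exact le_closure _⟩
  refine ⟨n, hn, c, ?_⟩
  rw [← hc]
  exact (IsLocallyPrincipal.closure_span_pow hs hA.ne_bot hinv.isLocallyPrincipal n).symm

/-- Elements `∗`-homogeneous at the same maximal `∗`-ideal and with principal powers above are
comparable up to powers. -/
lemma HasPrincipalPowersAbove.pow_dvd_pow_or (hs : s.FiniteCharacter) {P : Ideal D} {c d : D}
    (h : s.HasPrincipalPowersAbove (Ideal.span {c}) P)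
    (hc : s.IsHomogeneousAt (Ideal.span {c}) P) (hd : s.IsHomogeneousAt (Ideal.span {d}) P) :
    ∃ n : ℕ, 0 < n ∧ (c ^ n ∣ d ^ n ∨ d ^ n ∣ c ^ n) := by
  -- Divisibility at `P` is global here, since `a` is a unit at every other maximal `∗`-ideal.
  have glob : ∀ {a b : D} {n : ℕ}, s.IsHomogeneousAt (Ideal.span {a}) P →
      (∃ t ∉ P, a ^ n ∣ t * b ^ n) → a ^ n ∣ b ^ n := by
    rintro a b n ha ⟨t, ht, hdvd⟩
    have ha0 : a ≠ 0 := by simpa using ha.ne_bot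
    rw [← Ideal.mem_span_singleton, ← closure_span_singleton (s := s)]
    refine hs.mem_closure_of_local (by simpa using pow_ne_zero n ha0) fun Q hQ => ?_
    rw [closure_span_singleton]
    by_cases hQP : Q = P
    · exact ⟨t, hQP ▸ ht, Ideal.mem_span_singleton.mpr hdvd⟩
    · refine ⟨a ^ n, fun hmem => hQP (ha.unique Q hQ ?_),
        Ideal.mem_span_singleton.mpr (dvd_mul_right _ _)⟩
      rw [Ideal.span_singleton_le_iff_mem]
      exact hQ.isPrime.mem_of_pow_mem n hmem
  have hcd0 : Ideal.span {c, d} ≠ ⊥ := fun h0 => hc.ne_bot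
    (le_bot_iff.mp (h0 ▸ Ideal.span_mono (by simp)))
  obtain ⟨n, hn, e, he⟩ := h {c, d} (by simp)
    (by rintro x (rfl | rfl)
        · exact hc.le (Ideal.mem_span_singleton_self _)
        · exact hd.le (Ideal.mem_span_singleton_self _))
    ⟨1, one_pos, by rw [pow_one]; exact (Ideal.span_mono (by simp)).trans (le_closure _)⟩
  obtain ⟨t, ht, _, ⟨g, hg, rfl⟩, hdvd⟩ := isLocallyPrincipal_of_closure_eq_span_singleton
    (span_pow_image_ne_bot hcd0 n) he P hc.isMaximal
  refine ⟨n, hn, ?_⟩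
  rcases hg with rfl | rfl
  · exact Or.inl (glob hc ⟨t, ht, hdvd _ ⟨d, by simp, rfl⟩⟩)
  · exact Or.inr (glob hd ⟨t, ht, hdvd _ ⟨c, by simp, rfl⟩⟩)

/-- A nonempty product of `∗`-afg-homogeneous ideals at `P` contains, up to `∗`-closure, a
`∗`-homogeneous element at `P` with principal powers above. -/
lemma exists_mem_closure_prod (hs : s.FiniteCharacter) {P : Ideal D} (L : Multiset (Ideal D))
    (hL : ∀ A ∈ L, s.IsInvertible (A : FractionalIdeal D⁰ K) ∧ s.IsHomogeneousAt A P ∧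
      s.HasPrincipalPowersAbove A P) : L = 0 ∨
    ∃ c ∈ s.closure L.prod, s.IsHomogeneousAt (Ideal.span {c}) P ∧
      s.HasPrincipalPowersAbove (Ideal.span {c}) P := by
  induction L using Multiset.induction_on with
  | empty => exact Or.inl rfl
  | cons A L ih =>
    right
    obtain ⟨hinv, hA, hpow⟩ := hL A (Multiset.mem_cons_self A L)
    obtain ⟨n, hn, c, hc⟩ := hpow.exists_closure_pow hs hA hinv
    have hcA : c ∈ s.closure A :=
      closure_mono (Ideal.pow_le_self hn.ne') (hc ▸ Ideal.mem_span_singleton_self c)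
    have hchom := isHomogeneousAt_span_singleton hA hn hc
    have hcpow := hpow.of_pow_le hn (B := Ideal.span {c}) (by
      rw [closure_span_singleton, ← hc]; exact le_closure _)
    rcases ih fun B hB => hL B (Multiset.mem_cons_of_mem hB) with rfl | ⟨d, hdL, hdhom, hdpow⟩
    · exact ⟨c, by simpa using hcA, hchom, hcpow⟩
    -- Here `e` is whichever of `c`, `d` has its `m`-th power divisible by that of the other; then
    -- `e ^ (2 * m)` absorbs both `c ^ m` and `d ^ m`.
    have step : ∀ {e : D} {m : ℕ}, 0 < m → s.IsHomogeneousAt (Ideal.span {e}) P →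
        s.HasPrincipalPowersAbove (Ideal.span {e}) P → c ^ m * d ^ m ∣ e ^ (2 * m) →
        ∃ c ∈ s.closure (A ::ₘ L).prod, s.IsHomogeneousAt (Ideal.span {c}) P ∧
          s.HasPrincipalPowersAbove (Ideal.span {c}) P := by
      intro e m hm he hepow hdvd
      have h2m : 0 < 2 * m := by omega
      have hspan : s.closure (Ideal.span {e} ^ (2 * m)) = Ideal.span {e ^ (2 * m)} := by
        rw [Ideal.span_singleton_pow, closure_span_singleton]
      refine ⟨e ^ (2 * m), ?_, isHomogeneousAt_span_singleton he h2m hspan,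
        hepow.of_pow_le h2m ?_⟩
      · rw [Multiset.prod_cons]
        refine Ideal.mem_of_dvd _ (dvd_trans ?_ hdvd)
          (closure_mul_closure_le A L.prod (Ideal.mul_mem_mul hcA hdL))
        exact mul_dvd_mul (dvd_pow_self c hm.ne') (dvd_pow_self d hm.ne')
      · rw [Ideal.span_singleton_pow]
        exact le_closure _
    obtain ⟨m, hm, hdvd | hdvd⟩ := hcpow.pow_dvd_pow_or hs hchom hdhom
    · exact step hm hdhom hdpow (by rw [two_mul, pow_add]; exact mul_dvd_mul_right hdvd _)
    · exact step hm hchom hcpow (by rw [two_mul, pow_add]; exact mul_dvd_mul_left _ hdvd)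

end Afg

end StarOperation

/-- A finite set has, after raising to a common power, a generator locally at `P` as soon as any
two elements do. -/
lemma Ideal.exists_pow_dvd_of_finset {D : Type*} [CommRing D] (P : Ideal D) [hP : P.IsPrime]
    (h : ∀ a b : D, ∃ n : ℕ, 0 < n ∧ ∃ t ∉ P, a ^ n ∣ t * b ^ n ∨ b ^ n ∣ t * a ^ n)
    (S : Finset D) (hS : S.Nonempty) :
    ∃ n : ℕ, 0 < n ∧ ∃ t ∉ P, ∃ b ∈ S, ∀ x ∈ S, b ^ n ∣ t * x ^ n := by
  classical
  have lift : ∀ {a b t : D} {n : ℕ} (m : ℕ), a ^ n ∣ t * b ^ n →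
      a ^ (n * m) ∣ t ^ m * b ^ (n * m) := fun m hd => by
    rw [pow_mul, pow_mul, ← mul_pow]
    exact pow_dvd_pow_of_dvd hd m
  induction hS using Finset.Nonempty.cons_induction with
  | singleton a => exact ⟨1, one_pos, 1, hP.one_notMem, a, by simp, by simp⟩
  | cons a S _ _ ih =>
    obtain ⟨n, hn, t, ht, b, hb, hbS⟩ := ih
    obtain ⟨m, hm, u, hu, hab⟩ := h a b
    have htu : t ^ m * u ^ n ∉ P := hP.mul_notMem
      (fun hc => ht (hP.mem_of_pow_mem _ hc)) (fun hc => hu (hP.mem_of_pow_mem _ hc))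
    -- The new element `a` is compared only with the generator `b` of the smaller set; `n * m` is a
    -- common exponent for both relations.
    refine ⟨n * m, Nat.mul_pos hn hm, t ^ m * u ^ n, htu, ?_⟩
    rcases hab with hab | hab
    · have h1 := lift n hab
      rw [mul_comm m n] at h1
      refine ⟨a, Finset.mem_cons_self a S, fun x hx => ?_⟩
      rcases Finset.mem_cons.mp hx with rfl | hx
      · exact dvd_mul_left _ _
      · refine h1.trans ?_
        rw [mul_comm (t ^ m), mul_assoc]
        exact mul_dvd_mul_left _ (lift m (hbS x hx))
    · have h1 := lift n hab
      rw [mul_comm m n] at h1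
      refine ⟨b, Finset.mem_cons_of_mem hb, fun x hx => ?_⟩
      rcases Finset.mem_cons.mp hx with rfl | hx
      · rw [mul_assoc]
        exact h1.mul_left _
      · rw [mul_comm (t ^ m), mul_assoc]
        exact (lift m (hbS x hx)).mul_left _

/-! ### The implications between the four conditions. -/

namespace StarOperation

variable {D K : Type*} [CommRing D] [IsDomain D] [Field K] [Algebra D K] [IsFractionRing D K]
  {s : StarOperation D K}

lemma isAfgSHDomain_iff : s.IsAfgSHDomain ↔ ∀ x : D, x ≠ 0 → ¬ IsUnit x →
    ∃ L : Multiset (Ideal D), (∀ A ∈ L, s.IsAfgHomogeneous A) ∧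
      s.closure L.prod = Ideal.span {x} := by
  simp only [IsAfgSHDomain, eq_comm (b := s.star _), star_eq_coe_iff]

/-- A prime containing `x` contains one of its finitely many factors, and each factor lies in a
single maximal `∗`-ideal. This gives finiteness, and independence for primes below two maximal
`∗`-ideals. -/
lemma IsAfgSHDomain.isHLocal (hs : s.FiniteCharacter) (h : s.IsAfgSHDomain) : s.IsHLocal := by
  rw [isAfgSHDomain_iff] at h
  have key : ∀ x : D, x ≠ 0 → ∃ L : Multiset (Ideal D), (∀ A ∈ L, s.IsHomogeneous A) ∧
      s.closure L.prod = Ideal.span {x} := by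
    intro x hx
    by_cases hu : IsUnit x
    · refine ⟨0, by simp, ?_⟩
      rw [Ideal.span_singleton_eq_top.mpr hu, Multiset.prod_zero, Ideal.one_eq_top, closure_top]
    · obtain ⟨L, hL, hx⟩ := h x hx hu
      exact ⟨L, fun A hA => let ⟨P, hP, _⟩ := (hL A hA).2; ⟨P, hP⟩, hx⟩
  refine (isHLocal_iff hs).mpr ⟨fun x hx => ?_, fun P Q hP hQ hne N hN hN0 hNP hNQ => ?_⟩
  · obtain ⟨L, hL, hLx⟩ := key x hx
    choose! M hM using hL
    refine ((L.map M).finite_toSet).subset ?_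
    rintro P ⟨hP, hxP⟩
    have hle : L.prod ≤ P := by
      rwa [← hP.closure_le_iff, hLx, Ideal.span_singleton_le_iff_mem]
    obtain ⟨A, hA, hAP⟩ := hP.isPrime.multiset_prod_le.mp hle
    exact Multiset.mem_map.mpr ⟨A, hA, ((hM A hA).unique P hP hAP).symm⟩
  · obtain ⟨x, hxN, hx0⟩ := (Submodule.ne_bot_iff _).mp hN0
    obtain ⟨L, hL, hLx⟩ := key x hx0
    have hle : L.prod ≤ N := by
      refine (le_closure (s := s) _).trans ?_
      rwa [hLx, Ideal.span_singleton_le_iff_mem]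
    obtain ⟨A, hA, hAN⟩ := hN.multiset_prod_le.mp hle
    obtain ⟨M, hM⟩ := hL A hA
    exact hne ((hM.unique P hP (hAN.trans hNP)).trans (hM.unique Q hQ (hAN.trans hNQ)).symm)

lemma IsAfgSHDomain.isAfgHomogeneous (hs : s.FiniteCharacter) (h : s.IsAfgSHDomain) {A : Ideal D}
    (hinv : s.IsInvertible (A : FractionalIdeal D⁰ K)) (hA : s.IsHomogeneous A) :
    s.IsAfgHomogeneous A := by
  classical
  rw [isAfgSHDomain_iff] at h
  obtain ⟨P, hAP⟩ := hA
  have hP := hAP.isMaximal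
  have hPp := hP.isPrime
  refine isAfgHomogeneous_iff.mpr ⟨hinv, P, hAP, ?_⟩
  rintro S hS hSP ⟨r, hr, hAr⟩
  obtain ⟨x, hxA, hx0⟩ := (Submodule.ne_bot_iff _).mp hAP.ne_bot
  obtain ⟨L, hL, hLx⟩ := h x hx0 fun hu => hPp.ne_top (P.eq_top_of_isUnit_mem (hAP.le hxA) hu)
  have hsplit := congrArg Multiset.prod (Multiset.filter_add_not (fun B => B ≤ P) L)
  rw [Multiset.prod_add] at hsplit
  set L₁ := L.filter (fun B => B ≤ P) with hL₁
  set L₂ := L.filter (fun B => ¬ B ≤ P) with hL₂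
  have hnot : ¬ L₂.prod ≤ P := by
    rw [hPp.multiset_prod_le]
    rintro ⟨B, hB, hBP⟩
    exact (Multiset.mem_filter.mp hB).2 hBP
  obtain ⟨t, htL, htP⟩ := SetLike.not_le_iff_exists.mp hnot
  obtain h0 | ⟨c, hcL, hc, hcpow⟩ := exists_mem_closure_prod hs (P := P) L₁ fun B hB => by
    obtain ⟨hBL, hBP⟩ := Multiset.mem_filter.mp hB
    obtain ⟨hBinv, Q, hBQ, hpow⟩ := isAfgHomogeneous_iff.mp (hL B hBL)
    obtain rfl := hBQ.unique P hP hBP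
    exact ⟨hBinv, hBQ, hpow⟩
  · rw [h0, Multiset.prod_zero, one_mul] at hsplit
    refine absurd ?_ hnot
    rw [hsplit, ← hP.closure_le_iff, hLx, Ideal.span_singleton_le_iff_mem]
    exact hAP.le hxA
  have hxct : x ∣ c * t := by
    rw [← Ideal.mem_span_singleton, ← hLx, ← hsplit]
    exact closure_mul_closure_le _ _ (Ideal.mul_mem_mul hcL (le_closure _ htL))
  -- It suffices that `c ^ r` lies in the closure of `(S)`. At `P`, `x ^ r ∣ (c * t) ^ r` puts it in
  -- `A ^ r` up to the factor `t ^ r`; elsewhere `S` contains a local unit.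
  refine hcpow S hS hSP ⟨r, hr, ?_⟩
  have hS0 : Ideal.span S ≠ ⊥ := by
    intro h0
    rw [h0, closure_bot, le_bot_iff] at hAr
    exact pow_ne_zero r hAP.ne_bot hAr
  rw [Ideal.span_singleton_pow, Ideal.span_singleton_le_iff_mem]
  refine hs.mem_closure_of_local hS0 fun Q hQ => ?_
  have hQp := hQ.isPrime
  by_cases hQP : Q = P
  · subst hQP
    refine ⟨t ^ r, fun hc => htP (hQp.mem_of_pow_mem r hc), hAr ?_⟩
    rw [← mul_pow, mul_comm]
    exact Ideal.mem_of_dvd _ (pow_dvd_pow_of_dvd hxct r) (Ideal.pow_mem_pow hxA r)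
  · have hSQ : ¬ Ideal.span S ≤ Q := by
      intro hle
      have h1 := hAr.trans (hQ.closure_le_iff.mpr hle)
      exact hQP (hAP.unique Q hQ ((hQp.pow_le_iff hr.ne').mp h1))
    obtain ⟨y, hy, hyQ⟩ := SetLike.not_le_iff_exists.mp hSQ
    exact ⟨y, hyQ, le_closure _ (Ideal.mul_mem_right _ _ hy)⟩

lemma IsHLocal.isAfgSHDomain (hs : s.FiniteCharacter) (h : s.IsHLocal)
    (hom : ∀ A : Ideal D, s.IsInvertible (A : FractionalIdeal D⁰ K) →
      s.IsHomogeneous A → s.IsAfgHomogeneous A) : s.IsAfgSHDomain := by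
  refine isAfgSHDomain_iff.mpr fun x hx _ => ?_
  obtain ⟨L, hL, hxL⟩ := h.exists_factorization hs (isInvertible_span_singleton hx)
  exact ⟨L, fun A hA => hom A (hL A hA).1 (hL A hA).2, by rw [← hxL, closure_span_singleton]⟩

lemma IsHLocal.isAVDomain_localization (hs : s.FiniteCharacter) (h : s.IsHLocal)
    (hom : ∀ A : Ideal D, s.IsInvertible (A : FractionalIdeal D⁰ K) →
      s.IsHomogeneous A → s.IsAfgHomogeneous A) {P : Ideal D} [hPp : P.IsPrime]
    (hP : s.IsMaximalStarIdeal P) : IsAVDomain (Localization.AtPrime P) := by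
  classical
  rw [isAVDomain_localization_iff]
  intro a b
  by_cases ha : a = 0
  · exact ⟨1, one_pos, 1, hPp.one_notMem, Or.inr (by simp [ha])⟩
  by_cases hb : b = 0
  · exact ⟨1, one_pos, 1, hPp.one_notMem, Or.inl (by simp [hb])⟩
  by_cases haP : a ∈ P
  swap
  · exact ⟨1, one_pos, a, haP, Or.inl (by simp)⟩
  by_cases hbP : b ∈ P
  swap
  · exact ⟨1, one_pos, b, hbP, Or.inr (by simp)⟩
  obtain ⟨A, hA, hAinv, haA, t, ht, hta⟩ := h.exists_isHomogeneousAt hs hP ha haP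
  obtain ⟨B, hB, -, hbB, u, hu, hub⟩ := h.exists_isHomogeneousAt hs hP hb hbP
  obtain ⟨-, Q, hAQ, hpow⟩ := isAfgHomogeneous_iff.mp (hom A hAinv ⟨P, hA⟩)
  obtain rfl := hAQ.unique P hP hA.le
  obtain ⟨G, hG⟩ := hA.fg
  have hGA : ∀ x ∈ G, x ∈ A := fun x hx => hG ▸ Ideal.subset_span hx
  have hAS : A ≤ Ideal.span (↑(insert a (insert b G)) : Set D) := by
    rw [← hG]
    exact Ideal.span_mono fun x hx => by simp [Finset.mem_coe.mp hx]
  have hSP : ∀ x ∈ insert a (insert b G), x ∈ P := by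
    intro x hx
    simp only [Finset.mem_insert] at hx
    rcases hx with rfl | rfl | hx
    exacts [haP, hbP, hA.le (hGA x hx)]
  obtain ⟨n, hn, c, hc⟩ := hpow _ (Finset.finite_toSet (insert a (insert b G))) hSP
    ⟨1, one_pos, by rw [pow_one]; exact hAS.trans (le_closure _)⟩
  obtain ⟨v, hv, _, ⟨g, hg, rfl⟩, hdvd⟩ := isLocallyPrincipal_of_closure_eq_span_singleton
    (span_pow_image_ne_bot (fun h0 => hA.ne_bot (le_bot_iff.mp (h0 ▸ hAS))) n) hc P hP
  refine ⟨n, hn, ?_⟩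
  have main : ∀ {x y w : D}, w ∉ P → x ∣ w * g → y ∈ insert a (insert b G) →
      ∃ t ∉ P, x ^ n ∣ t * y ^ n := by
    intro x y w hw hx hy
    refine ⟨w ^ n * v, hPp.mul_notMem (fun hc => hw (hPp.mem_of_pow_mem n hc)) hv, ?_⟩
    refine (pow_dvd_pow_of_dvd hx n).trans ?_
    rw [mul_pow, mul_assoc]
    exact mul_dvd_mul_left _ (hdvd _ ⟨y, hy, rfl⟩)
  -- The local generator comes from some `g` among `a`, `b` and the generators of `A`. Unless `g =
  -- b`, it lies in `A`, where `a` divides everything at `P`, so `a ^ n` divides `b ^ n` locally.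
  by_cases hgb : g = b
  · obtain ⟨w, hw, h1⟩ := main (x := b) (y := a) hPp.one_notMem (by rw [hgb, one_mul])
      (by simp)
    exact ⟨w, hw, Or.inr h1⟩
  · have hgA : g ∈ A := by
      simp only [Finset.coe_insert, Set.mem_insert_iff, Finset.mem_coe] at hg
      rcases hg with rfl | rfl | hg
      exacts [haA, absurd rfl hgb, hGA g hg]
    obtain ⟨w, hw, h1⟩ := main (x := a) (y := b) ht (hta g hgA) (by simp)
    exact ⟨w, hw, Or.inl h1⟩

lemma IsHLocal.isMulTorsion_of_isAfgHomogeneous (hs : s.FiniteCharacter) (h : s.IsHLocal)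
    (hom : ∀ A : Ideal D, s.IsInvertible (A : FractionalIdeal D⁰ K) →
      s.IsHomogeneous A → s.IsAfgHomogeneous A) : IsMulTorsion s.StarClassGroup := by
  refine h.torsion_of_homogeneous hs fun A hinv hA => ?_
  obtain ⟨-, P, hAP, hpow⟩ := isAfgHomogeneous_iff.mp (hom A hinv hA)
  exact hpow.exists_closure_pow hs hAP hinv

/-- If the class group is torsion, locally principal sets have principal powers. -/
lemma IsLocallyPrincipal.exists_closure_span_pow (hs : s.FiniteCharacter)
    (htors : IsMulTorsion s.StarClassGroup) {S : Set D} (hS : Ideal.span S ≠ ⊥)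
    (h : s.IsLocallyPrincipal S) :
    ∃ n : ℕ, 0 < n ∧ ∃ c : D, s.closure (Ideal.span ((· ^ n) '' S)) = Ideal.span {c} := by
  obtain ⟨n, hn, c, hc⟩ := isMulTorsion_starClassGroup_iff.mp htors _ (h.isInvertible hs hS)
  exact ⟨n, hn, c, by rw [h.closure_span_pow hs hS, hc]⟩

lemma IsAlmostIRKT.exists_pow_dvd (h : s.IsAlmostIRKT) {P : Ideal D}
    (hP : s.IsMaximalStarIdeal P) (a b : D) :
    ∃ n : ℕ, 0 < n ∧ ∃ t ∉ P, a ^ n ∣ t * b ^ n ∨ b ^ n ∣ t * a ^ n := by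
  have := hP.isPrime
  exact (isAVDomain_localization_iff P).mp (h.2 ⟨P, hP.isPrime⟩ hP) a b

/-- Almost valuation makes the `n`-th powers of `S` locally principal at `P`. At any other `Q`, some
element of `S` is a unit, since a power of `A` lies in the closure. Torsion supplies a further
exponent `m`. -/
lemma IsAlmostIRKT.isAfgHomogeneous (hs : s.FiniteCharacter) (h : s.IsAlmostIRKT)
    (htors : IsMulTorsion s.StarClassGroup) {A : Ideal D}
    (hinv : s.IsInvertible (A : FractionalIdeal D⁰ K)) (hA : s.IsHomogeneous A) :
    s.IsAfgHomogeneous A := by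
  obtain ⟨P, hAP⟩ := hA
  have hP := hAP.isMaximal
  have hPp := hP.isPrime
  refine isAfgHomogeneous_iff.mpr ⟨hinv, P, hAP, ?_⟩
  rintro S hS hSP ⟨r, hr, hAr⟩
  have hS0 : Ideal.span S ≠ ⊥ := by
    intro h0
    rw [h0, closure_bot, le_bot_iff] at hAr
    exact pow_ne_zero r hAP.ne_bot hAr
  have hSne : hS.toFinset.Nonempty := by
    rw [Set.Finite.toFinset_nonempty]
    by_contra hne
    rw [Set.not_nonempty_iff_eq_empty] at hne
    exact hS0 (by rw [hne, Ideal.span_empty])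
  obtain ⟨n, hn, t, ht, b, hb, hbS⟩ := Ideal.exists_pow_dvd_of_finset P
    (fun a b => h.exists_pow_dvd hP a b) hS.toFinset hSne
  simp only [Set.Finite.mem_toFinset] at hb hbS
  have hloc : s.IsLocallyPrincipal ((· ^ n) '' S) := by
    intro Q hQ
    have hQp := hQ.isPrime
    by_cases hQP : Q = P
    · subst hQP
      refine ⟨t, ht, b ^ n, ⟨b, hb, rfl⟩, ?_⟩
      rintro _ ⟨x, hx, rfl⟩
      exact hbS x hx
    · have hSQ : ¬ S ⊆ Q := by
        intro hle
        have h1 := hAr.trans (hQ.closure_le_iff.mpr (Ideal.span_le.mpr hle))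
        exact hQP (hAP.unique Q hQ ((hQp.pow_le_iff hr.ne').mp h1))
      obtain ⟨y, hy, hyQ⟩ := Set.not_subset.mp hSQ
      exact ⟨y ^ n, fun hc => hyQ (hQp.mem_of_pow_mem n hc), y ^ n, ⟨y, hy, rfl⟩,
        fun x _ => dvd_mul_right _ _⟩
  obtain ⟨m, hm, c, hc⟩ := hloc.exists_closure_span_pow hs htors (span_pow_image_ne_bot hS0 n)
  refine ⟨n * m, Nat.mul_pos hn hm, c, ?_⟩
  rw [← hc, Set.image_image]
  simp only [pow_mul]

/-- Only the finitely many `P ∋ a` matter, since `a` is a unit at the others; the product of their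
exponents makes the pair locally principal everywhere. -/
lemma IsAlmostIRKT.isAGCDDomain (hs : s.FiniteCharacter) (h : s.IsAlmostIRKT)
    (htors : IsMulTorsion s.StarClassGroup) : IsAGCDDomain D K := by
  intro a b ha hb
  have hfin := ((isHLocal_iff hs).mp h.1).1 a ha
  have hab0 : Ideal.span {a, b} ≠ ⊥ := by
    rw [Ne, Ideal.span_eq_bot]
    exact fun h0 => ha (h0 a (by simp))
  choose! N hN hab using fun P (hP : s.IsMaximalStarIdeal P) => h.exists_pow_dvd hP a b
  have hF : ∀ P ∈ hfin.toFinset, 0 < N P := fun P hP => hN P (by simpa using hP : _ ∧ _).1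
  set n := ∏ P ∈ hfin.toFinset, N P with hn
  have hn0 : 0 < n := Finset.prod_pos hF
  have hloc : s.IsLocallyPrincipal ((· ^ n) '' {a, b}) := by
    intro P hP
    have hPp := hP.isPrime
    rw [Set.image_pair]
    by_cases haP : a ∈ P
    · obtain ⟨m, hm⟩ : N P ∣ n := Finset.dvd_prod_of_mem N (by simpa using ⟨hP, haP⟩)
      obtain ⟨t, ht, hdvd⟩ := hab P hP
      refine ⟨t ^ m, fun hc => ht (hPp.mem_of_pow_mem m hc), ?_⟩
      rcases hdvd with hdvd | hdvd
      · refine ⟨a ^ n, by simp, ?_⟩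
        rintro x (rfl | rfl)
        · exact dvd_mul_left _ _
        · rw [hm, pow_mul, pow_mul, ← mul_pow]
          exact pow_dvd_pow_of_dvd hdvd m
      · refine ⟨b ^ n, by simp, ?_⟩
        rintro x (rfl | rfl)
        · rw [hm, pow_mul, pow_mul, ← mul_pow]
          exact pow_dvd_pow_of_dvd hdvd m
        · exact dvd_mul_left _ _
    · exact ⟨a ^ n, fun hc => haP (hPp.mem_of_pow_mem n hc), a ^ n, by simp,
        fun x _ => dvd_mul_right _ _⟩
  have hn' := span_pow_image_ne_bot hab0 n
  obtain ⟨m, hm, c, hc⟩ := hloc.exists_closure_span_pow hs htors hn'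
  have himage : (· ^ m) '' ((· ^ n) '' {a, b}) = {a ^ (n * m), b ^ (n * m)} := by
    rw [Set.image_pair, Set.image_pair, pow_mul, pow_mul]
  have hinv := (hloc.pow m).isInvertible hs (span_pow_image_ne_bot hn' m)
  rw [himage] at hinv hc
  exact ⟨n * m, Nat.mul_pos hn0 hm, c, by rw [hinv.inv_inv_eq_star, star_eq_coe_iff, hc]⟩

/-- A homogeneous invertible `A` has the closure of `(a, y)`, with `a` a generator at `P` and `y ∈
A` outside the other maximal `∗`-ideals containing `a`. The almost GCD property is then applied to
`a` and `y`. -/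
lemma IsHLocal.isMulTorsion_of_isAGCDDomain (hs : s.FiniteCharacter) (h : s.IsHLocal)
    (hgcd : IsAGCDDomain D K) : IsMulTorsion s.StarClassGroup := by
  classical
  refine h.torsion_of_homogeneous hs fun A hinv ⟨P, hAP⟩ => ?_
  have hP := hAP.isMaximal
  obtain ⟨t, ht, a, haA, hta⟩ := hinv.exists_local_generator hP
  have ht0 : t ≠ 0 := fun h0 => ht (h0 ▸ P.zero_mem)
  have ha0 : a ≠ 0 := by
    rintro rfl
    obtain ⟨x, hxA, hx0⟩ := (Submodule.ne_bot_iff _).mp hAP.ne_bot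
    exact mul_ne_zero ht0 hx0 (zero_dvd_iff.mp (hta x hxA))
  have hfin := ((isHLocal_iff hs).mp h).1 a ha0
  -- Prime avoidance; `⊥` joins the family to force `y ≠ 0`, and fills both exceptional places of
  -- `Ideal.subset_union_prime`.
  obtain ⟨y, hyA, hy⟩ : ∃ y ∈ A, ∀ Q ∈ insert ⊥ (hfin.toFinset.erase P), y ∉ Q := by
    by_contra! hcon
    obtain ⟨Q, hQ, hAQ⟩ := (Ideal.subset_union_prime (s := insert ⊥ (hfin.toFinset.erase P))
      (f := id) ⊥ ⊥ (fun Q hQ hne _ => by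
        rw [Finset.mem_insert] at hQ
        have := Finset.mem_of_mem_erase (hQ.resolve_left hne)
        rw [Set.Finite.mem_toFinset] at this
        exact this.1.isPrime) (I := A)).mp fun y hy => by
          obtain ⟨Q, hQ, hyQ⟩ := hcon y hy
          exact Set.mem_biUnion (Finset.mem_coe.mpr hQ) hyQ
    rcases Finset.mem_insert.mp hQ with rfl | hQ
    · exact hAP.ne_bot (le_bot_iff.mp hAQ)
    · obtain ⟨hne, hQ⟩ := Finset.mem_erase.mp hQ
      rw [Set.Finite.mem_toFinset] at hQ
      exact hne (hAP.unique Q hQ.1 hAQ)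
  have hy0 : y ≠ 0 := fun h0 => hy ⊥ (Finset.mem_insert_self _ _) (by simp [h0])
  have hloc : ∀ Q, s.IsMaximalStarIdeal Q → ∃ u ∉ Q, ∃ g ∈ ({a, y} : Set D),
      ∀ x ∈ A, g ∣ u * x := by
    intro Q hQ
    by_cases hQP : Q = P
    · exact ⟨t, hQP ▸ ht, a, by simp, hta⟩
    by_cases haQ : a ∈ Q
    · refine ⟨y, hy Q ?_, y, by simp, fun x _ => dvd_mul_right _ _⟩
      exact Finset.mem_insert_of_mem (Finset.mem_erase.mpr ⟨hQP, by simpa using ⟨hQ, haQ⟩⟩)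
    · exact ⟨a, haQ, a, by simp, fun x _ => dvd_mul_right _ _⟩
  have hayA : ({a, y} : Set D) ⊆ A := by
    rintro x (rfl | rfl)
    exacts [haA, hyA]
  have hay0 : Ideal.span {a, y} ≠ ⊥ := by
    rw [Ne, Ideal.span_eq_bot]
    exact fun h0 => ha0 (h0 a (by simp))
  have hclosure : s.closure A = s.closure (Ideal.span {a, y}) := by
    refine le_antisymm (closure_le_iff.mpr ?_) (closure_mono (Ideal.span_le.mpr hayA))
    refine hs.le_closure_of_local hay0 fun Q hQ => ?_
    obtain ⟨u, hu, g, hg, hdvd⟩ := hloc Q hQ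
    refine ⟨u, hu, Ideal.span_singleton_mul_le_iff.mpr fun x hx => le_closure _ ?_⟩
    exact Ideal.mem_of_dvd _ (hdvd x hx) (Ideal.subset_span hg)
  have hay : s.IsLocallyPrincipal {a, y} := fun Q hQ =>
    let ⟨u, hu, g, hg, hdvd⟩ := hloc Q hQ
    ⟨u, hu, g, hg, fun x hx => hdvd x (hayA hx)⟩
  obtain ⟨n, hn, c, hc⟩ := hgcd a y ha0 hy0
  have hinv' := (hay.pow n).isInvertible hs (span_pow_image_ne_bot hay0 n)
  have hpow := hay.closure_span_pow hs hay0 n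
  rw [Set.image_pair] at hinv' hpow
  rw [hinv'.inv_inv_eq_star, star_eq_coe_iff, hpow] at hc
  exact ⟨n, hn, c, by rw [closure_pow_congr hclosure, hc]⟩

end StarOperation

theorem theorem5p5 {D K : Type*} [CommRing D] [IsDomain D] [Field K] [Algebra D K]
    [IsFractionRing D K] (s : StarOperation D K) (hs : s.FiniteCharacter) :
    List.TFAE [
      s.IsAfgSHDomain,
      s.IsAlmostIRKT ∧ IsAGCDDomain D K,
      s.IsAlmostIRKT ∧ IsMulTorsion s.StarClassGroup,
      s.IsHLocal ∧ ∀ A : Ideal D, s.IsInvertible (A : FractionalIdeal D⁰ K) →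
        s.IsHomogeneous A → s.IsAfgHomogeneous A] := by
  tfae_have 1 → 4 := fun h => ⟨h.isHLocal hs, fun _ => h.isAfgHomogeneous hs⟩
  tfae_have 4 → 1 := fun h => h.1.isAfgSHDomain hs h.2
  tfae_have 4 → 3 := fun h => ⟨⟨h.1, fun _ hP => h.1.isAVDomain_localization hs h.2 hP⟩,
    h.1.isMulTorsion_of_isAfgHomogeneous hs h.2⟩
  tfae_have 3 → 4 := fun h => ⟨h.1.1, fun _ => h.1.isAfgHomogeneous hs h.2⟩
  tfae_have 3 → 2 := fun h => ⟨h.1, h.1.isAGCDDomain hs h.2⟩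
  tfae_have 2 → 3 := fun h => ⟨h.1, h.1.1.isMulTorsion_of_isAGCDDomain hs h.2⟩
  tfae_finish
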